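/- For point vortices $x_i\in S^2\subset\mathbb R^3$ ($x_i\ne x_j$ for $i\neq j$) with vorticities $\kappa_i\neq0$, let $H(x)=-\sum_{i<j}\kappa_i\kappa_j\ln(1-x_i\cdot x_j)$, let $\omega=\sum_i\kappa_i\sin\theta_i\,d\theta_i\wedge d\phi_i$ ($\theta_i$ the co-latitude and $\phi_i$ the longitude of $x_i$), $\Phi(x)=\sum_i\kappa_i x_i$, and $H_\xi=H-\langle\Phi,\xi\rangle$ for $\xi\in\mathbb R^3$. A configuration $x_e$ is a relative equilibrium with angular velocity $\xi$ if it is a critical point of $H_\xi$. With $\mu=\Phi(x_e)$ and $\mathfrak{so}(3)_\mu=\{\eta\in\mathbb R^3:\eta\times\mu=0\}$ acting by $x_i\mapsto\eta\times x_i$, let $\mathcal N=(\mathfrak{so}(3)_\mu\cdot x_e)^\perp\cap\ker D\Phi(x_e)$ be the symplectic slice, and let $L_{\mathcal N}:\mathcal N\to\mathcal N$ be the linearized system, defined by $\omega(w,L_{\mathcal N}v)=d^2H_\xi(x_e)(w,v)$ for all $v,w\in\mathcal N$. The relative equilibrium is linearly unstable if $L_{\mathcal N}$ has an eigenvalue with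 positive real part (equivalently, with non-zero real part). Let $n\ge4$, $0<\theta_0<\pi$, and $\kappa_N,\kappa_S\in\mathbb R\setminus\{0\}$. Let $x_e$ be the $\mathbf C_{nv}(R,2p)$ configuration of $n$ vortices of vorticity $1$ at co-latitude $\theta_0$ and longitudes $2\pi s/n$, $s=1,\dots,n$, together with a vortex of vorticity $\kappa_N$ at the North pole and one of vorticity $\kappa_S$ at the South pole. Assume $\mu=\Phi(x_e)\neq0$. Put $c_n=n^2/4$ for $n$ even and $c_n=(n^2-1)/4$ for $n$ odd. For $2\le\ell\le[n/2]$, the $\ell$-mode is the span of the real and imaginary parts of $\sum_{s}e^{2\pi i\ell s/n}\,\delta\theta_s$ and $\sum_{s}e^{2\pi i\ell s/n}\,\delta\phi_s$, where $\delta\theta_s=\partial x_s/\partial\theta_s$ and $\delta\phi_s=\partial x_s/\partial\phi_s$. Then $x_e$ is a relative equilibrium for exactly one angular velocity $\xi$, the map $L_{\mathcal N}$ is well defined, and: 1. if $\kappa_N(1+\cos\theta_0)^2+\kappa_S(1-\cos\theta_0)^2<c_n-(n-1)(1+\cos^2\theta_0)$, then $x_e$ is linearly unstable; 2. if $\kappa_N(1+\cos\theta_0)^2+\kappa_S(1-\cos\theta_0)^2>c_n-(n-1)(1+\cos^2\theta_0)$,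 then $x_e$ is stable with respect to the $\ell\ge2$ modes: the span $M$ of all $\ell$-modes with $2\le\ell\le[n/2]$ lies in $\mathcal N$ and is $L_{\mathcal N}$-invariant, $d^2H_\xi(x_e)$ is definite on $M$, all eigenvalues of $L_{\mathcal N}|_M$ are purely imaginary, and all solutions of $\dot v=L_{\mathcal N}v$ in $M$ are bounded for $t\in\mathbb R$. -/

import Mathlib

open scoped Matrix

namespace PointVortex

noncomputable section

/-- Euclidean three-space; inner product `⬝ᵥ`, vector product `⨯₃`. -/
abbrev R3 : Type := Fin 3 → ℝ

/-! ### Point vortices on the sphere -/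

/-- The phase space: `x i` is the position of vortex `i` on the unit sphere, and
no two vortices coincide. -/
def phaseSpace (ι : Type) : Set (ι → R3) :=
  {x | (∀ i, x i ⬝ᵥ x i = 1) ∧ ∀ i j, i ≠ j → x i ≠ x j}

/-- `H(x) = - ∑_{i<j} κ_i κ_j ln (1 - x_i · x_j)`, written as half of the sum over the ordered
pairs `i ≠ j`. -/
def hamiltonian {ι : Type} [Fintype ι] [DecidableEq ι] (κ : ι → ℝ) (x : ι → R3) : ℝ :=
  -(1 / 2 : ℝ) * ∑ i, ∑ j ∈ Finset.univ.erase i, κ i * κ j * Real.log (1 - x i ⬝ᵥ x j)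

/-- The momentum map `Φ(x) = ∑ κ_i x_i`. It is linear in `x`, so that `momentum κ u` is also its
differential in the direction `u`. -/
def momentum {ι : Type} [Fintype ι] (κ : ι → ℝ) (x : ι → R3) : R3 := ∑ i, κ i • x i

/-- The augmented Hamiltonian `H_ξ = H - ⟨Φ, ξ⟩`. -/
def augmented {ι : Type} [Fintype ι] [DecidableEq ι] (κ : ι → ℝ) (ξ : R3) (x : ι → R3) : ℝ :=
  hamiltonian κ x - momentum κ x ⬝ᵥ ξ

/-- The radial projection onto the product of unit spheres. For `x` in the phase space and `u`
tangent at `x`, the map `u ↦ radial (x + u)` is a local parametrization of the phase space near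
`x` (central projection from the tangent planes) with differential the identity at `u = 0`. -/
def radial {ι : Type} (y : ι → R3) : ι → R3 := fun i => (Real.sqrt (y i ⬝ᵥ y i))⁻¹ • y i

/-- The tangent space of the phase space at `x`. -/
def tangentSpace {ι : Type} (x : ι → R3) : Submodule ℝ (ι → R3) where
  carrier := {u | ∀ i, x i ⬝ᵥ u i = 0}
  add_mem' := by
    intro u v hu hv i
    simp [dotProduct_add, hu i, hv i]
  zero_mem' := by
    intro i
    simp
  smul_mem' := by
    intro c u hu i
    simp [dotProduct_smul, hu i]

/-- `x` is a relative equilibrium with angular velocity `ξ`: a critical point of `H_ξ` on the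
phase space. -/
def IsRelativeEquilibrium {ι : Type} [Fintype ι] [DecidableEq ι] (κ : ι → ℝ) (x : ι → R3)
    (ξ : R3) : Prop :=
  x ∈ phaseSpace ι ∧
    ∀ u ∈ tangentSpace x, fderiv ℝ (fun y => augmented κ ξ (radial y)) x u = 0

/-- The Hessian `d²H_ξ(x)` of `H_ξ` on the phase space at a critical point `x`, evaluated at two
tangent vectors (computed in the local parametrization `u ↦ radial (x + u)`; at a
critical point the Hessian does not depend on the parametrization). -/
def hessian {ι : Type} [Fintype ι] [DecidableEq ι] (κ : ι → ℝ) (ξ : R3) (x u v : ι → R3) : ℝ :=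
  fderiv ℝ (fderiv ℝ (fun y => augmented κ ξ (radial y))) x u v

/-- The symplectic form: the sum of the area forms `sin θ_i dθ_i ∧ dφ_i` of the spheres,
weighted by the vorticities. -/
def symplecticForm {ι : Type} [Fintype ι] (κ : ι → ℝ) (x u v : ι → R3) : ℝ :=
  ∑ i, κ i * (x i ⬝ᵥ (u i ⨯₃ v i))

/-- The symplectic slice `N = (so(3)_μ · x)^⊥ ∩ Ker DΦ(x)` inside the tangent space at `x`, where
`μ = Φ(x)`, `so(3)_μ = {η | η × μ = 0}`, and `η ∈ so(3)` acts by `x_i ↦ η × x_i`. The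
orthogonal complement is for the product Riemannian metric. -/
def slice {ι : Type} [Fintype ι] (κ : ι → ℝ) (x : ι → R3) : Submodule ℝ (ι → R3) where
  carrier := {u | u ∈ tangentSpace x ∧ momentum κ u = 0 ∧
    ∀ η : R3, η ⨯₃ momentum κ x = 0 → ∑ i, (η ⨯₃ x i) ⬝ᵥ u i = 0}
  add_mem' := by
    rintro u v ⟨hu, hu', hu''⟩ ⟨hv, hv', hv''⟩
    refine ⟨add_mem hu hv, ?_, fun η hη => ?_⟩
    · have : momentum κ (u + v) = momentum κ u + momentum κ v := by
        simp [momentum, Finset.sum_add_distrib]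
      rw [this, hu', hv', add_zero]
    · simp [dotProduct_add, Finset.sum_add_distrib, hu'' η hη, hv'' η hη]
  zero_mem' := by
    refine ⟨zero_mem _, by simp [momentum], fun η _ => by simp⟩
  smul_mem' := by
    rintro c u ⟨hu, hu', hu''⟩
    refine ⟨Submodule.smul_mem _ c hu, ?_, fun η hη => ?_⟩
    · have : momentum κ (c • u) = c • momentum κ u := by
        simp [momentum, Finset.smul_sum, smul_comm c]
      rw [this, hu', smul_zero]
    · simp only [Pi.smul_apply, dotProduct_smul, ← Finset.smul_sum, hu'' η hη, smul_zero]

/-- `L` is the linearized system `L_N` on the symplectic slice `N`: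
`L_N = J_N d²H_ξ|_N`, with `J_N` the inverse of `ω|_N`, that is, `ω(w, L v) = d²H_ξ(w, v)`
for all `w, v ∈ N`. -/
def IsSliceLinearization {ι : Type} [Fintype ι] [DecidableEq ι] (κ : ι → ℝ) (ξ : R3)
    (x : ι → R3) (L : slice κ x →ₗ[ℝ] slice κ x) : Prop :=
  ∀ w v : slice κ x, symplecticForm κ x w (L v) = hessian κ ξ x w v

/-- Linear instability of the linear system `v' = L v`: `L` has a complex eigenvalue with positive
real part. (The spectrum of an infinitesimally symplectic `L` is invariant under `z ↦ -z`, so this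
amounts to having an eigenvalue with non-zero real part.) -/
def IsLinearlyUnstable {V : Type} [AddCommGroup V] [Module ℝ V] (L : V →ₗ[ℝ] V) : Prop :=
  ∃ z : ℂ, 0 < z.re ∧ Module.End.HasEigenvalue (L.baseChange ℂ) z

/-- The relative equilibrium `x` is stable with respect to the modes that make up the subspace `M`
of the tangent space: `M` lies in the symplectic slice and is invariant under `L = L_N`, the
Hessian of `H_ξ` is definite on `M`, the eigenvalues of `L` on `M` are purely imaginary, and all
solutions of `v' = L v` in `M` are bounded. -/
def IsStableOnModes {ι : Type} [Fintype ι] [DecidableEq ι] (κ : ι → ℝ) (ξ : R3) (x : ι → R3)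
    (L : slice κ x →ₗ[ℝ] slice κ x) (M : Submodule ℝ (ι → R3)) : Prop :=
  M ≤ slice κ x ∧
  ((∀ v ∈ M, v ≠ 0 → 0 < hessian κ ξ x v v) ∨ (∀ v ∈ M, v ≠ 0 → hessian κ ξ x v v < 0)) ∧
  ∃ hM : ∀ v ∈ M.submoduleOf (slice κ x), L v ∈ M.submoduleOf (slice κ x),
    (∀ z : ℂ, Module.End.HasEigenvalue ((L.restrict hM).baseChange ℂ) z → z.re = 0) ∧
    ∀ v : ℝ → M.submoduleOf (slice κ x),
      (∀ t, HasDerivAt v (L.restrict hM (v t)) t) → ∃ C : ℝ, ∀ t, ‖v t‖ ≤ C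

/-! ### A ring and two polar vortices -/

/-- Longitude of the `s`-th vortex of the ring. -/
def longitude (n : ℕ) (s : Fin n) : ℝ := 2 * Real.pi * (s : ℕ) / n

/-- The ring consists of `n` vortices of strength `1`; the polar vortices have strengths `κN`
(North) and `κS` (South). -/
def ringVorticity (n : ℕ) (κN κS : ℝ) : Fin n ⊕ Fin 2 → ℝ :=
  Sum.elim (fun _ => 1) ![κN, κS]

/-- The configuration `C_{nv}(R,2p)`: a regular ring of `n` vortices at co-latitude `θ`, together
with one vortex at the North pole and one at the South pole. -/
def ringConfig (n : ℕ) (θ : ℝ) : Fin n ⊕ Fin 2 → R3 :=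
  Sum.elim
    (fun s => ![Real.sin θ * Real.cos (longitude n s), Real.sin θ * Real.sin (longitude n s),
      Real.cos θ])
    ![![0, 0, 1], ![0, 0, -1]]

/-- The tangent vector `∑_s a_s δθ_s` at the configuration, where `δθ_s = ∂x_s/∂θ`. -/
def thetaVariation (n : ℕ) (θ : ℝ) (a : Fin n → ℝ) : Fin n ⊕ Fin 2 → R3 :=
  Sum.elim
    (fun s => a s • ![Real.cos θ * Real.cos (longitude n s),
      Real.cos θ * Real.sin (longitude n s), -Real.sin θ])
    0

/-- The tangent vector `∑_s a_s δφ_s` at the configuration, where `δφ_s = ∂x_s/∂φ`. -/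
def phiVariation (n : ℕ) (θ : ℝ) (a : Fin n → ℝ) : Fin n ⊕ Fin 2 → R3 :=
  Sum.elim
    (fun s => a s • ![-(Real.sin θ * Real.sin (longitude n s)),
      Real.sin θ * Real.cos (longitude n s), 0])
    0

/-- The `ℓ`-th mode: the span of the real and imaginary parts of `∑_s exp(2πiℓs/n) δθ_s` and
of `∑_s exp(2πiℓs/n) δφ_s`. -/
def mode (n : ℕ) (θ : ℝ) (l : ℕ) : Submodule ℝ (Fin n ⊕ Fin 2 → R3) :=
  Submodule.span ℝ
    {thetaVariation n θ (fun s => Real.cos (l * longitude n s)),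
      thetaVariation n θ (fun s => Real.sin (l * longitude n s)),
      phiVariation n θ (fun s => Real.cos (l * longitude n s)),
      phiVariation n θ (fun s => Real.sin (l * longitude n s))}

/-- The span of all the `ℓ`-modes with `2 ≤ ℓ ≤ [n/2]`. -/
def higherModes (n : ℕ) (θ : ℝ) : Submodule ℝ (Fin n ⊕ Fin 2 → R3) :=
  ⨆ l ∈ Finset.Icc 2 (n / 2), mode n θ l

/-- `c_n = n²/4` for `n` even and `(n² - 1)/4` for `n` odd. -/
def ringConst (n : ℕ) : ℝ := if Even n then (n : ℝ) ^ 2 / 4 else ((n : ℝ) ^ 2 - 1) / 4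

end

end PointVortex

/-! On Fourier variations of the ring of order `l` with `2 ≤ l ≤ n / 2`, everything is explicit. The
pair interaction within the ring is governed by the kernel `1 / (1 - cos φ)`, and its difference
operator multiplies `cos (l φ + d)` by `l (n - l)` (`sum_mode_sub_div`). The poles do not couple to
these modes: a tangent vector at a pole is horizontal, so it sees only Fourier coefficients of order
one.

Hence pairing with a mode through the Hessian is a multiple of pairing with it through the metric:
the factor is `λ_l / sin² θ` for the `θ`-part, where `λ_l = κN (1 + cos θ)² + κS (1 - cos θ)² + (n -
1)(1 + cos² θ) - l (n - l)`, and `l (n - l) / sin² θ > 0` for the `φ`-part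
(`hessian_thetaVariation`, `hessian_phiVariation`). The symplectic form pairs meridians with
parallels, so the linearization exchanges the two parts: `L δθ = (λ_l / sin³ θ) δφ` and `L δφ = -(l
(n - l) / sin θ) δθ`. On such a block `L² = -λ_l l (n - l) / sin⁴ θ`.

The number `λ_l` is smallest at `l = n / 2` (rounded down), where `l (n - l) = c_n`, so the two
alternatives of the theorem are the two signs of this smallest value. If it is negative, the
corresponding block has a positive real eigenvalue. If it is positive, the Hessian is positive
definite on all the modes together; since `L` is skew for it, the eigenvalues are imaginary and the
Hessian is a conserved norm.

That `L` exists and is unique rests on `slice_nondegenerate`: the kernel of `DΦ` is the symplectic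
complement of the group orbit, and the slice removes exactly its degenerate directions. -/

namespace PointVortex

/-! ### Derivatives of the augmented Hamiltonian -/

/-- The radial projection of a single vector onto the unit sphere. -/
noncomputable def unitVec (p : R3) : R3 := (Real.sqrt (p ⬝ᵥ p))⁻¹ • p

theorem radial_apply {ι : Type} (y : ι → R3) (i : ι) : radial y i = unitVec (y i) := rfl

/-- The differential of `unitVec` at `p` in the direction `v`. -/
noncomputable def unitVecDeriv (p v : R3) : R3 :=
  (Real.sqrt (p ⬝ᵥ p))⁻¹ • v - ((Real.sqrt (p ⬝ᵥ p))⁻¹ ^ 3 * (p ⬝ᵥ v)) • p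

theorem unitVec_of_unit {p : R3} (hp : p ⬝ᵥ p = 1) : unitVec p = p := by
  simp [unitVec, hp]

theorem unitVecDeriv_of_unit {p v : R3} (hp : p ⬝ᵥ p = 1) (hv : p ⬝ᵥ v = 0) :
    unitVecDeriv p v = v := by
  simp [unitVecDeriv, hp, hv]

theorem hasDerivAt_dotProduct {f g : ℝ → R3} {f' g' : R3} {t : ℝ} (hf : HasDerivAt f f' t)
    (hg : HasDerivAt g g' t) :
    HasDerivAt (fun s => f s ⬝ᵥ g s) (f' ⬝ᵥ g t + f t ⬝ᵥ g') t := by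
  have hf := hasDerivAt_pi.1 hf
  have hg := hasDerivAt_pi.1 hg
  simp only [dotProduct, ← Finset.sum_add_distrib]
  exact HasDerivAt.fun_sum fun i _ => (hf i).mul (hg i)

theorem hasDerivAt_line {E : Type*} [NormedAddCommGroup E] [NormedSpace ℝ E] (p v : E) (s : ℝ) :
    HasDerivAt (fun t : ℝ => p + t • v) v s := by
  simpa using ((hasDerivAt_id s).smul_const v).const_add p

theorem contDiffAt_dotProduct {E : Type*} [NormedAddCommGroup E] [NormedSpace ℝ E] {f g : E → R3}
    {x : E} {m : WithTop ℕ∞} (hf : ContDiffAt ℝ m f x) (hg : ContDiffAt ℝ m g x) :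
    ContDiffAt ℝ m (fun y => f y ⬝ᵥ g y) x := by
  simp only [dotProduct]
  exact ContDiffAt.sum fun i _ => (contDiffAt_pi.1 hf i).mul (contDiffAt_pi.1 hg i)

theorem dotProduct_self_nonneg_R3 (p : R3) : 0 ≤ p ⬝ᵥ p := by
  simpa [dotProduct] using Finset.sum_nonneg fun i _ => mul_self_nonneg (p i)

theorem contDiffAt_unitVec {p : R3} (hp : p ⬝ᵥ p ≠ 0) {m : WithTop ℕ∞} :
    ContDiffAt ℝ m unitVec p := by
  have h : ContDiffAt ℝ m (fun p : R3 => p ⬝ᵥ p) p :=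
    contDiffAt_dotProduct contDiffAt_id contDiffAt_id
  have h0 := dotProduct_self_nonneg_R3 p
  exact ((h.sqrt hp).inv (Real.sqrt_ne_zero'.2 (lt_of_le_of_ne h0 hp.symm))).smul contDiffAt_id

theorem hasDerivAt_inv_norm {p v : R3} (hp : p ⬝ᵥ p ≠ 0) :
    HasDerivAt (fun t : ℝ => (Real.sqrt ((p + t • v) ⬝ᵥ (p + t • v)))⁻¹)
      (-((Real.sqrt (p ⬝ᵥ p))⁻¹ ^ 3 * (p ⬝ᵥ v))) 0 := by
  have h0 := dotProduct_self_nonneg_R3 p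
  have h1 : Real.sqrt (p ⬝ᵥ p) ≠ 0 := Real.sqrt_ne_zero'.2 (lt_of_le_of_ne h0 hp.symm)
  have hl := hasDerivAt_line p v 0
  have h := ((hasDerivAt_dotProduct hl hl).sqrt (by simpa using hp)).fun_inv (by simpa using h1)
  refine h.congr_deriv ?_
  simp only [zero_smul, add_zero]
  rw [dotProduct_comm v p]
  field_simp
  ring

theorem hasDerivAt_unitVec {p v : R3} (hp : p ⬝ᵥ p ≠ 0) :
    HasDerivAt (fun t : ℝ => unitVec (p + t • v)) (unitVecDeriv p v) 0 := by
  refine ((hasDerivAt_inv_norm hp (v := v)).fun_smul (hasDerivAt_line p v 0)).congr_deriv ?_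
  simp only [zero_smul, add_zero, unitVecDeriv, neg_smul, ← sub_eq_add_neg]

/-- The second derivative of the radial projection is the curvature of the sphere, normal to it. It
is the source of the terms `u i ⬝ᵥ v i` in the Hessian. -/
theorem hasDerivAt_unitVecDeriv {p u v : R3} (hp : p ⬝ᵥ p = 1) (hu : p ⬝ᵥ u = 0)
    (hv : p ⬝ᵥ v = 0) :
    HasDerivAt (fun t : ℝ => unitVecDeriv (p + t • u) v) (-(u ⬝ᵥ v) • p) 0 := by
  have hr := hasDerivAt_inv_norm (p := p) (v := u) (by simp [hp])
  have hl := hasDerivAt_line p u 0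
  refine ((hr.smul_const v).fun_sub (((hr.fun_pow 3).fun_mul
    (hasDerivAt_dotProduct hl (hasDerivAt_const 0 v))).fun_smul hl)).congr_deriv ?_
  simp [hp, hu, hv]

/-- The derivative of `ln (1 - p · q)` along a curve. -/
theorem hasDerivAt_log_one_sub_dotProduct {f g : ℝ → R3} {f' g' : R3} {t : ℝ}
    (hf : HasDerivAt f f' t) (hg : HasDerivAt g g' t) (h : 1 - f t ⬝ᵥ g t ≠ 0) :
    HasDerivAt (fun s => Real.log (1 - f s ⬝ᵥ g s))
      (-(f' ⬝ᵥ g t + f t ⬝ᵥ g') / (1 - f t ⬝ᵥ g t)) t :=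
  ((hasDerivAt_dotProduct hf hg).const_sub 1).log h

/-- For unit vectors, `|p - q|² = 2 (1 - p · q)`. -/
theorem one_sub_dotProduct_ne_zero {p q : R3} (hp : p ⬝ᵥ p = 1) (hq : q ⬝ᵥ q = 1) (h : p ≠ q) :
    1 - p ⬝ᵥ q ≠ 0 := by
  intro h1
  apply h
  have : (p - q) ⬝ᵥ (p - q) = 0 := by
    simp only [sub_dotProduct, dotProduct_sub, hp, hq, dotProduct_comm q p]
    linarith
  exact sub_eq_zero.1 (dotProduct_self_eq_zero.1 this)

/-- The open set on which the augmented Hamiltonian composed with `radial` is smooth. -/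
def regularSet (ι : Type) : Set (ι → R3) :=
  {y | (∀ i, y i ⬝ᵥ y i ≠ 0) ∧ ∀ i j, i ≠ j → 1 - unitVec (y i) ⬝ᵥ unitVec (y j) ≠ 0}

theorem phaseSpace_subset_regularSet {ι : Type} : phaseSpace ι ⊆ regularSet ι := by
  rintro x ⟨h1, h2⟩
  refine ⟨fun i => by simp [h1 i], fun i j hij => ?_⟩
  rw [unitVec_of_unit (h1 i), unitVec_of_unit (h1 j)]
  exact one_sub_dotProduct_ne_zero (h1 i) (h1 j) (h2 i j hij)

variable {ι : Type} [Fintype ι] [DecidableEq ι]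

theorem contDiffAt_augmented_radial (κ : ι → ℝ) (ξ : R3) {y : ι → R3} (hy : y ∈ regularSet ι)
    {m : WithTop ℕ∞} : ContDiffAt ℝ m (fun y => augmented κ ξ (radial y)) y := by
  have hN : ∀ i, ContDiffAt ℝ m (fun y : ι → R3 => unitVec (y i)) y := fun i =>
    (contDiffAt_unitVec (hy.1 i)).comp y (contDiff_apply ℝ R3 i).contDiffAt
  unfold augmented hamiltonian momentum
  refine ContDiffAt.sub (contDiffAt_const.mul (ContDiffAt.sum fun i _ => ContDiffAt.sum
    fun j hj => contDiffAt_const.mul (ContDiffAt.log ?_ ?_))) (contDiffAt_dotProduct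
    (ContDiffAt.sum fun i _ => contDiffAt_const.fun_smul (hN i)) contDiffAt_const)
  · exact contDiffAt_const.sub (contDiffAt_dotProduct (hN i) (hN j))
  · exact hy.2 i j (Finset.ne_of_mem_erase hj).symm

/-- A second differentiation along a line needs the formula for the first differential at all nearby
points of that line, which leave the product of spheres. -/
theorem eventually_mem_regularSet {x : ι → R3} (hx : x ∈ phaseSpace ι) (u : ι → R3) :
    ∀ᶠ t : ℝ in nhds 0, x + t • u ∈ regularSet ι := by
  have hx' := phaseSpace_subset_regularSet hx
  have hl : ∀ i, HasDerivAt (fun t : ℝ => x i + t • u i) (u i) 0 := fun i => hasDerivAt_line _ _ 0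
  refine Filter.Eventually.and ?_ ?_
  · refine Filter.eventually_all.2 fun i => ?_
    have := (hasDerivAt_dotProduct (hl i) (hl i)).continuousAt
    exact this.eventually_ne (by simpa using hx'.1 i)
  · refine Filter.eventually_all.2 fun i => Filter.eventually_all.2 fun j => ?_
    by_cases hij : i = j
    · simp [hij]
    have hN := fun i => hasDerivAt_unitVec (p := x i) (v := u i) (hx'.1 i)
    have := ((hasDerivAt_dotProduct (hN i) (hN j)).const_sub 1).continuousAt
    filter_upwards [this.eventually_ne (by simpa using hx'.2 i j hij)] with t ht _ using ht

/-- The differential of the augmented Hamiltonian composed with `radial`. -/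
theorem fderiv_augmented_radial (κ : ι → ℝ) (ξ : R3) {y : ι → R3} (hy : y ∈ regularSet ι)
    (v : ι → R3) :
    fderiv ℝ (fun y => augmented κ ξ (radial y)) y v =
      -(1 / 2 : ℝ) * (∑ i, ∑ j ∈ Finset.univ.erase i, κ i * κ j *
        (-(unitVecDeriv (y i) (v i) ⬝ᵥ unitVec (y j) + unitVec (y i) ⬝ᵥ unitVecDeriv (y j) (v j)) /
          (1 - unitVec (y i) ⬝ᵥ unitVec (y j)))) - ∑ i, κ i * (unitVecDeriv (y i) (v i) ⬝ᵥ ξ) := by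
  -- Smoothness gives the differential; its value is then identified by differentiating along a
  -- line.
  have hF := ((contDiffAt_augmented_radial κ ξ hy (m := 1)).differentiableAt
    (by simp)).hasFDerivAt
  have h1 : HasDerivAt (fun t : ℝ => augmented κ ξ (radial (y + t • v)))
      (fderiv ℝ (fun y => augmented κ ξ (radial y)) y v) 0 := by
    refine HasFDerivAt.comp_hasDerivAt (l := fun y => augmented κ ξ (radial y)) 0 ?_
      (hasDerivAt_line y v 0)
    simpa using hF
  have hN := fun i => hasDerivAt_unitVec (p := y i) (v := v i) (hy.1 i)
  refine h1.unique ?_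
  unfold augmented hamiltonian momentum
  refine HasDerivAt.fun_sub (HasDerivAt.const_mul _ (HasDerivAt.fun_sum fun i _ =>
    HasDerivAt.fun_sum fun j hj => HasDerivAt.const_mul _ ?_)) ?_
  · have := hasDerivAt_log_one_sub_dotProduct (hN i) (hN j)
      (by simpa using hy.2 i j (Finset.ne_of_mem_erase hj).symm)
    simpa [radial_apply] using this
  · simp only [sum_dotProduct, smul_dotProduct, smul_eq_mul]
    refine HasDerivAt.fun_sum fun i _ => HasDerivAt.const_mul _ ?_
    simpa [radial_apply] using hasDerivAt_dotProduct (hN i) (hasDerivAt_const 0 ξ)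

/-- This turns the symmetric sum over pairs into a sum of one row per vortex, so that the
equilibrium condition and the Hessian can be treated vortex by vortex. -/
theorem half_sum_offDiag_symm (f : ι → ι → ℝ) :
    (1 / 2 : ℝ) * ∑ i, ∑ j ∈ Finset.univ.erase i, (f i j + f j i) =
      ∑ i, ∑ j ∈ Finset.univ.erase i, f i j := by
  have h : ∑ i, ∑ j ∈ Finset.univ.erase i, f j i = ∑ i, ∑ j ∈ Finset.univ.erase i, f i j :=
    Finset.sum_comm' fun i j => by simp [eq_comm]
  simp only [Finset.sum_add_distrib, h]
  ring

theorem fderiv_augmented_radial_of_tangent (κ : ι → ℝ) (ξ : R3) {x : ι → R3}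
    (hx : x ∈ phaseSpace ι) {u : ι → R3} (hu : u ∈ tangentSpace x) :
    fderiv ℝ (fun y => augmented κ ξ (radial y)) x u =
      ∑ i, κ i * (u i ⬝ᵥ (∑ j ∈ Finset.univ.erase i, (κ j / (1 - x i ⬝ᵥ x j)) • x j - ξ)) := by
  rw [fderiv_augmented_radial κ ξ (phaseSpace_subset_regularSet hx)]
  simp only [unitVec_of_unit (hx.1 _), unitVecDeriv_of_unit (hx.1 _) (hu _)]
  set f : ι → ι → ℝ := fun i j => κ i * (κ j / (1 - x i ⬝ᵥ x j) * (u i ⬝ᵥ x j)) with hf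
  have h : ∀ i j, κ i * κ j * (-(u i ⬝ᵥ x j + x i ⬝ᵥ u j) / (1 - x i ⬝ᵥ x j)) =
      -(f i j + f j i) := fun i j => by
    simp only [hf, dotProduct_comm (x j) (x i), dotProduct_comm (u j) (x i)]
    ring
  simp only [h, Finset.sum_neg_distrib, neg_mul_neg, half_sum_offDiag_symm]
  simp only [hf, dotProduct_sub, dotProduct_sum, dotProduct_smul, mul_sub, Finset.sum_sub_distrib,
    Finset.mul_sum, smul_eq_mul]

/-- The differential in the fixed direction `v` is differentiated along `x + t • u`. Since `v` need
not stay tangent there, `unitVecDeriv` varies with `t` and contributes the curvature terms. -/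
theorem hessian_eq_pairs (κ : ι → ℝ) (ξ : R3) {x : ι → R3}
    (hx : x ∈ phaseSpace ι) {u v : ι → R3} (hu : u ∈ tangentSpace x) (hv : v ∈ tangentSpace x) :
    hessian κ ξ x u v =
      (1 / 2 : ℝ) * (∑ i, ∑ j ∈ Finset.univ.erase i, κ i * κ j *
        ((u i ⬝ᵥ v j + v i ⬝ᵥ u j - (u i ⬝ᵥ v i + u j ⬝ᵥ v j) * (x i ⬝ᵥ x j)) /
          (1 - x i ⬝ᵥ x j) + (u i ⬝ᵥ x j + x i ⬝ᵥ u j) * (v i ⬝ᵥ x j + x i ⬝ᵥ v j) /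
          (1 - x i ⬝ᵥ x j) ^ 2)) + ∑ i, κ i * ((u i ⬝ᵥ v i) * (x i ⬝ᵥ ξ)) := by
  have hx' := phaseSpace_subset_regularSet hx
  have hF : DifferentiableAt ℝ (fderiv ℝ (fun y => augmented κ ξ (radial y))) x :=
    ((contDiffAt_augmented_radial κ ξ hx' (m := 2)).fderiv_right (m := 1)
      (by norm_num)).differentiableAt (by simp)
  have h1 : HasDerivAt (fun t : ℝ => fderiv ℝ (fun y => augmented κ ξ (radial y)) (x + t • u) v)
      (hessian κ ξ x u v) 0 := by
    have h2 : HasDerivAt (fun t : ℝ => fderiv ℝ (fun y => augmented κ ξ (radial y)) (x + t • u))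
        (fderiv ℝ (fderiv ℝ (fun y => augmented κ ξ (radial y))) x u) 0 := by
      refine HasFDerivAt.comp_hasDerivAt (l := fderiv ℝ (fun y => augmented κ ξ (radial y))) 0 ?_
        (hasDerivAt_line x u 0)
      simpa using hF.hasFDerivAt
    simpa [hessian] using h2.clm_apply (hasDerivAt_const 0 v)
  have hN : ∀ i, HasDerivAt (fun t : ℝ => unitVec (x i + t • u i)) (u i) 0 := fun i => by
    simpa only [unitVecDeriv_of_unit (hx.1 i) (hu i)] using
      hasDerivAt_unitVec (p := x i) (v := u i) (hx'.1 i)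
  have hD : ∀ i, HasDerivAt (fun t : ℝ => unitVecDeriv (x i + t • u i) (v i))
    (-(u i ⬝ᵥ v i) • x i) 0 := fun i => hasDerivAt_unitVecDeriv (hx.1 i) (hu i) (hv i)
  refine h1.unique (HasDerivAt.congr_of_eventuallyEq ?_ ((eventually_mem_regularSet hx u).mono
    fun t ht => fderiv_augmented_radial κ ξ ht v))
  have hG := HasDerivAt.fun_sub (HasDerivAt.const_mul (-(1 / 2 : ℝ)) (HasDerivAt.fun_sum
    (u := Finset.univ) fun i _ => HasDerivAt.fun_sum (u := Finset.univ.erase i) fun j hj =>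
      HasDerivAt.const_mul (κ i * κ j) ((((hasDerivAt_dotProduct (hD i) (hN j)).fun_add
        (hasDerivAt_dotProduct (hN i) (hD j))).fun_neg).fun_div
        ((hasDerivAt_dotProduct (hN i) (hN j)).const_sub 1)
        (by simpa using hx'.2 i j (Finset.ne_of_mem_erase hj).symm))))
    (HasDerivAt.fun_sum (u := Finset.univ) fun i _ => HasDerivAt.const_mul (κ i)
      (hasDerivAt_dotProduct (hD i) (hasDerivAt_const 0 ξ)))
  refine hG.congr_deriv ?_
  simp only [zero_smul, add_zero, unitVec_of_unit (hx.1 _), dotProduct_zero,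
    unitVecDeriv_of_unit (hx.1 _) (hv _), smul_dotProduct, dotProduct_smul, smul_eq_mul]
  rw [sub_eq_add_neg, ← Finset.sum_neg_distrib, neg_mul, ← mul_neg, ← Finset.sum_neg_distrib]
  congr 1
  · congr 1
    refine Finset.sum_congr rfl fun i _ => ?_
    rw [← Finset.sum_neg_distrib]
    refine Finset.sum_congr rfl fun j hj => ?_
    have hne := one_sub_dotProduct_ne_zero (hx.1 i) (hx.1 j)
      (hx.2 i j (Finset.ne_of_mem_erase hj).symm)
    field_simp
    ring
  · refine Finset.sum_congr rfl fun i _ => ?_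
    ring

/-- The Hessian at tangent vectors, as a sum over the components of the first one. -/
theorem hessian_eq_rows (κ : ι → ℝ) (ξ : R3) {x : ι → R3}
    (hx : x ∈ phaseSpace ι) {u v : ι → R3} (hu : u ∈ tangentSpace x) (hv : v ∈ tangentSpace x) :
    hessian κ ξ x u v =
      ∑ i, κ i * (∑ j ∈ Finset.univ.erase i, κ j *
        ((u i ⬝ᵥ v j - (u i ⬝ᵥ v i) * (x i ⬝ᵥ x j)) / (1 - x i ⬝ᵥ x j) +
          (u i ⬝ᵥ x j) * (v i ⬝ᵥ x j + x i ⬝ᵥ v j) / (1 - x i ⬝ᵥ x j) ^ 2) +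
        (u i ⬝ᵥ v i) * (x i ⬝ᵥ ξ)) := by
  rw [hessian_eq_pairs κ ξ hx hu hv]
  set f : ι → ι → ℝ := fun i j => κ i * (κ j *
    ((u i ⬝ᵥ v j - (u i ⬝ᵥ v i) * (x i ⬝ᵥ x j)) / (1 - x i ⬝ᵥ x j) +
      (u i ⬝ᵥ x j) * (v i ⬝ᵥ x j + x i ⬝ᵥ v j) / (1 - x i ⬝ᵥ x j) ^ 2)) with hf
  have h : ∀ i j, κ i * κ j *
      ((u i ⬝ᵥ v j + v i ⬝ᵥ u j - (u i ⬝ᵥ v i + u j ⬝ᵥ v j) * (x i ⬝ᵥ x j)) /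
        (1 - x i ⬝ᵥ x j) + (u i ⬝ᵥ x j + x i ⬝ᵥ u j) * (v i ⬝ᵥ x j + x i ⬝ᵥ v j) /
        (1 - x i ⬝ᵥ x j) ^ 2) = f i j + f j i := fun i j => by
    simp only [hf, dotProduct_comm (x j) (x i), dotProduct_comm (u j) (x i),
      dotProduct_comm (v j) (x i), dotProduct_comm (x j) (v i), dotProduct_comm (u j) (v i)]
    ring
  simp only [h, half_sum_offDiag_symm]
  simp only [hf, mul_add, Finset.mul_sum, Finset.sum_add_distrib]

/-! ### The symplectic slice and the linearization -/

theorem cross_mem_tangentSpace {ι : Type} (x : ι → R3) (η : R3) :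
    (fun i => η ⨯₃ x i) ∈ tangentSpace x :=
  fun _ => dot_cross_self _ _

section Slice

variable {ι : Type} [Fintype ι]

theorem triple_swap (p u v : R3) : p ⬝ᵥ (u ⨯₃ v) = -(p ⬝ᵥ (v ⨯₃ u)) := by
  rw [← cross_anticomm, dotProduct_neg]

theorem symplecticForm_swap (κ : ι → ℝ) (x u v : ι → R3) :
    symplecticForm κ x u v = -symplecticForm κ x v u := by
  simp only [symplecticForm, ← Finset.sum_neg_distrib]
  exact Finset.sum_congr rfl fun i _ => by rw [triple_swap, mul_neg]

/-- The symplectic form as a bilinear form on all of `(ℝ³)^ι`. -/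
noncomputable def symplecticBilin (κ : ι → ℝ) (x : ι → R3) :
    (ι → R3) →ₗ[ℝ] (ι → R3) →ₗ[ℝ] ℝ :=
  LinearMap.mk₂ ℝ (symplecticForm κ x)
    (fun u v w => by simp [symplecticForm, mul_add, Finset.sum_add_distrib])
    (fun c u w => by
      simp only [symplecticForm, Pi.smul_apply, map_smul, LinearMap.smul_apply, dotProduct_smul,
        smul_eq_mul, Finset.mul_sum]
      exact Finset.sum_congr rfl fun i _ => by ring)
    (fun u v w => by simp [symplecticForm, mul_add, Finset.sum_add_distrib])
    (fun c u w => by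
      simp only [symplecticForm, Pi.smul_apply, map_smul, dotProduct_smul,
        smul_eq_mul, Finset.mul_sum]
      exact Finset.sum_congr rfl fun i _ => by ring)

theorem symplecticForm_smul (κ : ι → ℝ) (x u v : ι → R3) (c : ℝ) :
    symplecticForm κ x u (c • v) = c * symplecticForm κ x u v :=
  (symplecticBilin κ x u).map_smul c v

/-- The momentum map as a linear map. -/
noncomputable def momentumLin (κ : ι → ℝ) : (ι → R3) →ₗ[ℝ] R3 where
  toFun := momentum κ
  map_add' u v := by simp [momentum, Finset.sum_add_distrib]
  map_smul' c u := by simp [momentum, Finset.smul_sum, smul_comm c]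

/-- A functional that vanishes on the kernel of a linear map into `ℝ³` factors through it. -/
theorem exists_dotProduct_of_ker_le {V : Type*} [AddCommGroup V] [Module ℝ V] (Φ : V →ₗ[ℝ] R3)
    (f : V →ₗ[ℝ] ℝ) (h : ∀ v, Φ v = 0 → f v = 0) : ∃ η : R3, ∀ v, f v = η ⬝ᵥ Φ v := by
  have := mem_span_of_iInf_ker_le_ker (L := fun k : Fin 3 => (LinearMap.proj k).comp Φ) (K := f)
    (by
      intro v hv
      refine h v (funext fun k => ?_)
      simpa using (Submodule.mem_iInf _).1 hv k)
  obtain ⟨η, hη⟩ := (Submodule.mem_span_range_iff_exists_fun ℝ).1 this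
  refine ⟨η, fun v => ?_⟩
  simp [← hη, dotProduct]

/-- A tangent vector that is symplectically orthogonal to the kernel of the differential of the
momentum map is tangent to the group orbit. -/
theorem exists_cross_of_symplecticForm_eq_zero {κ : ι → ℝ} (hκ : ∀ i, κ i ≠ 0) {x u : ι → R3}
    (hx : x ∈ phaseSpace ι) (hu : u ∈ tangentSpace x)
    (h : ∀ w ∈ tangentSpace x, momentum κ w = 0 → symplecticForm κ x w u = 0) :
    ∃ η : R3, ∀ i, u i = η ⨯₃ x i := by
  -- `η` is a Lagrange multiplier: `ω(w, u)` vanishes whenever `DΦ(w)` does, hence equals `η ·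
  -- DΦ(w)`.
  obtain ⟨η, hη⟩ := exists_dotProduct_of_ker_le ((momentumLin κ).comp (tangentSpace x).subtype)
    (((symplecticBilin κ x).flip u).comp (tangentSpace x).subtype) (fun v hv => h v v.2 hv)
  classical
  -- The multiplier condition will give `u i × x i = η + c x i`; taking `x i ×` of this yields `u i
  -- = x i × η = -η × x i`.
  refine ⟨-η, fun i => ?_⟩
  -- The test variation moves vortex `i` alone, and `κ i ≠ 0` cancels.
  have key : ∀ z : R3, x i ⬝ᵥ z = 0 → z ⬝ᵥ (u i ⨯₃ x i - η) = 0 := by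
    intro z hz
    have hT : (Pi.single i z : ι → R3) ∈ tangentSpace x := by
      intro j
      by_cases hj : j = i
      · subst hj; simpa using hz
      · simp [Pi.single_eq_of_ne hj]
    have h1 := hη ⟨_, hT⟩
    simp only [LinearMap.comp_apply, Submodule.subtype_apply, LinearMap.flip_apply] at h1
    have h2 : symplecticForm κ x (Pi.single i z) u = κ i * (x i ⬝ᵥ (z ⨯₃ u i)) := by
      rw [symplecticForm, Finset.sum_eq_single i] <;> simp +contextual [Pi.single_eq_of_ne]
    have h3 : momentum κ (Pi.single i z) = κ i • z := by
      rw [momentum, Finset.sum_eq_single i] <;> simp +contextual [Pi.single_eq_of_ne]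
    have h4 : symplecticForm κ x (Pi.single i z) u = η ⬝ᵥ momentum κ (Pi.single i z) := h1
    rw [h2, h3, dotProduct_smul, smul_eq_mul] at h4
    have h5 := mul_left_cancel₀ (hκ i) h4
    rw [dotProduct_sub, ← triple_product_permutation, h5, dotProduct_comm, sub_self]
  have hxx := hx.1 i
  set b : R3 := u i ⨯₃ x i - η with hb
  have hz : x i ⬝ᵥ (b - (x i ⬝ᵥ b) • x i) = 0 := by
    rw [dotProduct_sub, dotProduct_smul, hxx, smul_eq_mul, mul_one, sub_self]
  -- The part of `b` orthogonal to `x i` is orthogonal to `b` by `key`, hence to itself.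
  have hz' : (b - (x i ⬝ᵥ b) • x i) = 0 := by
    rw [← dotProduct_self_eq_zero]
    nth_rewrite 2 [sub_eq_add_neg]
    rw [dotProduct_add, key _ hz, dotProduct_neg, dotProduct_smul, dotProduct_comm _ (x i), hz]
    simp
  have h1 : u i = x i ⨯₃ (u i ⨯₃ x i) := by
    rw [cross_cross_eq_smul_sub_smul', hxx, dotProduct_comm, hu i]
    simp
  have h2 : u i ⨯₃ x i = η + (x i ⬝ᵥ b) • x i := by
    rw [← sub_eq_zero.1 hz', hb]
    abel
  rw [h1, h2, map_add, map_smul, cross_self, smul_zero, add_zero, ← cross_anticomm, map_neg,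
    LinearMap.neg_apply]

theorem momentum_cross (κ : ι → ℝ) (x : ι → R3) (η : R3) :
    momentum κ (fun i => η ⨯₃ x i) = η ⨯₃ momentum κ x := by
  simp [momentum, map_sum]

/-- Expand `m × (η × m) = |m|² η - (m · η) m`. For `μ ≠ 0` this makes `so(3)_μ` the line through
`μ`. -/
theorem eq_smul_of_cross_eq_zero {η m : R3} (hm : m ≠ 0) (h : η ⨯₃ m = 0) :
    ∃ c : ℝ, η = c • m := by
  have h1 : m ⬝ᵥ m ≠ 0 := fun h => hm (dotProduct_self_eq_zero.1 h)
  refine ⟨(m ⬝ᵥ m)⁻¹ * (m ⬝ᵥ η), ?_⟩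
  have h2 : (m ⬝ᵥ m) • η - (m ⬝ᵥ η) • m = 0 := by
    rw [dotProduct_comm m η, ← cross_cross_eq_smul_sub_smul', h, map_zero]
  rw [mul_smul, ← sub_eq_zero.1 h2, inv_smul_smul₀ h1]

/-- Subtracting the orthogonal projection to the `SO(3)_μ`-orbit maps the kernel of the
differential of the momentum map to the symplectic slice. -/
theorem sub_mem_slice_of_mem_ker {κ : ι → ℝ} {x w : ι → R3} (hμ : momentum κ x ≠ 0)
    (hw : w ∈ tangentSpace x) (hw0 : momentum κ w = 0) :
    ∃ η : R3, η ⨯₃ momentum κ x = 0 ∧ (w - fun i => η ⨯₃ x i) ∈ slice κ x := by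
  set m := momentum κ x with hm
  set a := ∑ i, (m ⨯₃ x i) ⬝ᵥ w i with ha
  set b := ∑ i, (m ⨯₃ x i) ⬝ᵥ (m ⨯₃ x i) with hb
  have hab : a - a / b * b = 0 := by
    -- If the orbit direction `m × x` vanishes, then so does `a`, and the value `a / 0 = 0` is
    -- harmless.
    by_cases hb0 : b = 0
    · have h0 := (Finset.sum_eq_zero_iff_of_nonneg fun i _ =>
        dotProduct_self_nonneg_R3 (m ⨯₃ x i)).1 (hb.symm.trans hb0)
      rw [hb0, mul_zero, sub_zero, ha]
      exact Finset.sum_eq_zero fun i hi => by rw [dotProduct_self_eq_zero.1 (h0 i hi),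
        zero_dotProduct]
    · rw [div_mul_cancel₀ _ hb0, sub_self]
  have hcm : ((a / b) • m) ⨯₃ m = 0 := by
    rw [map_smul, LinearMap.smul_apply, cross_self, smul_zero]
  refine ⟨(a / b) • m, hcm, Submodule.sub_mem _ hw (cross_mem_tangentSpace x _), ?_, ?_⟩
  · change momentumLin κ (w - _) = 0
    rw [map_sub]
    change momentum κ w - momentum κ _ = 0
    rw [momentum_cross, hw0, hcm, sub_zero]
  · intro ζ hζ
    obtain ⟨d, rfl⟩ := eq_smul_of_cross_eq_zero hμ hζ
    simp only [map_smul, LinearMap.smul_apply, smul_dotProduct, smul_eq_mul, ← Finset.mul_sum,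
      Pi.sub_apply, dotProduct_sub, dotProduct_smul, Finset.sum_sub_distrib]
    rw [← ha, ← hb]
    linear_combination d * hab

/-- This is the defining property of a momentum map: rotations are the Hamiltonian fields of its
components, up to sign. -/
theorem symplecticForm_cross (κ : ι → ℝ) {x w : ι → R3} (hx : x ∈ phaseSpace ι)
    (hw : w ∈ tangentSpace x) (η : R3) :
    symplecticForm κ x w (fun i => η ⨯₃ x i) = -(η ⬝ᵥ momentum κ w) := by
  simp only [symplecticForm, momentum, dotProduct_sum, dotProduct_smul, smul_eq_mul,
    ← Finset.sum_neg_distrib]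
  refine Finset.sum_congr rfl fun i _ => ?_
  rw [cross_cross_eq_smul_sub_smul', dotProduct_sub, dotProduct_smul, dotProduct_smul, hx.1 i,
    dotProduct_comm (w i), hw i]
  simp

/-- A vector of `ker DΦ` differs from one of the slice by a rotation in `so(3)_μ`, which pairs to
zero with `u` because `DΦ(u) = 0`. So `u` is symplectically orthogonal to all of `ker DΦ` and is
therefore itself an infinitesimal rotation `η`. Now `DΦ(u) = η × μ = 0` puts `η` in `so(3)_μ`, and
the slice is orthogonal to that orbit; thus `u` is orthogonal to itself. -/
theorem slice_nondegenerate {κ : ι → ℝ} (hκ : ∀ i, κ i ≠ 0) {x : ι → R3} (hx : x ∈ phaseSpace ι)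
    (hμ : momentum κ x ≠ 0) {u : ι → R3} (hu : u ∈ slice κ x)
    (h : ∀ w ∈ slice κ x, symplecticForm κ x w u = 0) : u = 0 := by
  obtain ⟨η, hη⟩ := exists_cross_of_symplecticForm_eq_zero hκ hx hu.1 (fun w hw hw0 => by
    obtain ⟨ζ, hζ, hm⟩ := sub_mem_slice_of_mem_ker hμ hw hw0
    have h1 := h _ hm
    have h2 : symplecticForm κ x (w - fun i => ζ ⨯₃ x i) u = symplecticForm κ x w u -
      symplecticForm κ x (fun i => ζ ⨯₃ x i) u :=
      LinearMap.map_sub₂ (symplecticBilin κ x) _ _ _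
    rw [h2, symplecticForm_swap κ x (fun i => ζ ⨯₃ x i) u, symplecticForm_cross κ hx hu.1, hu.2.1] at h1
    simpa using h1)
  have hη0 : η ⨯₃ momentum κ x = 0 := by
    rw [← momentum_cross, ← hu.2.1]
    exact congrArg _ (funext fun i => (hη i).symm)
  have h1 := hu.2.2 η hη0
  simp only [← hη] at h1
  funext i
  exact dotProduct_self_eq_zero.1
    ((Finset.sum_eq_zero_iff_of_nonneg fun i _ => dotProduct_self_nonneg_R3 (u i)).1 h1 i
      (Finset.mem_univ i))

theorem eq_of_symplecticForm_eq {κ : ι → ℝ} (hκ : ∀ i, κ i ≠ 0) {x : ι → R3}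
    (hx : x ∈ phaseSpace ι) (hμ : momentum κ x ≠ 0) {u v : slice κ x}
    (h : ∀ w : slice κ x, symplecticForm κ x w u = symplecticForm κ x w v) : u = v := by
  rw [← sub_eq_zero]
  refine Subtype.ext (slice_nondegenerate hκ hx hμ (u - v).2 fun w hw => ?_)
  have h1 : symplecticForm κ x w (u - v) = symplecticForm κ x w u - symplecticForm κ x w v :=
    (symplecticBilin κ x w).map_sub _ _
  rw [Submodule.coe_sub, h1, sub_eq_zero]
  exact h ⟨w, hw⟩

/-- The symplectic form on the slice is nondegenerate, so the linearization exists and is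
unique. -/
theorem existsUnique_isSliceLinearization [DecidableEq ι] {κ : ι → ℝ} (hκ : ∀ i, κ i ≠ 0) {x : ι → R3}
    (hx : x ∈ phaseSpace ι) (hμ : momentum κ x ≠ 0) (ξ : R3) :
    ∃! L, IsSliceLinearization κ ξ x L := by
  let A : slice κ x →ₗ[ℝ] Module.Dual ℝ (slice κ x) :=
    (symplecticBilin κ x).flip.domRestrict₁₂ (slice κ x) (slice κ x)
  have hA : ∀ v w, A v w = symplecticForm κ x w v := fun v w => rfl
  have hinj : Function.Injective A := fun u v huv =>
    eq_of_symplecticForm_eq hκ hx hμ fun w => by rw [← hA, ← hA, huv]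
  let e := LinearMap.linearEquivOfInjective A hinj Subspace.dual_finrank_eq.symm
  let B : slice κ x →ₗ[ℝ] Module.Dual ℝ (slice κ x) :=
    LinearMap.mk₂ ℝ (fun v w => hessian κ ξ x w v)
      (fun u v w => by simp [hessian]) (fun c u w => by simp [hessian])
      (fun u v w => by simp [hessian]) (fun c u w => by simp [hessian])
  refine ⟨e.symm.toLinearMap.comp B, fun w v => ?_, fun L hL => ?_⟩
  · rw [← hA]
    change e (e.symm (B v)) w = _
    rw [e.apply_symm_apply]
    rfl
  · refine LinearMap.ext fun v => hinj ?_
    change A (L v) = e (e.symm (B v))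
    rw [e.apply_symm_apply]
    exact LinearMap.ext fun w => hL w v

/-- `L_N` is characterized by the symplectic form; a vector of the slice which satisfies its
defining equation is the image. -/
theorem IsSliceLinearization.apply_eq [DecidableEq ι] {κ : ι → ℝ} (hκ : ∀ i, κ i ≠ 0) {x : ι → R3}
    (hx : x ∈ phaseSpace ι) (hμ : momentum κ x ≠ 0) {ξ : R3} {L : slice κ x →ₗ[ℝ] slice κ x}
    (hL : IsSliceLinearization κ ξ x L) {v u : slice κ x}
    (h : ∀ w : slice κ x, symplecticForm κ x w u = hessian κ ξ x w v) : L v = u :=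
  eq_of_symplecticForm_eq hκ hx hμ fun w => by rw [hL w v, h w]

theorem hessian_symm [DecidableEq ι] {κ : ι → ℝ} {ξ : R3} {x : ι → R3} (hx : x ∈ phaseSpace ι) {u v : ι → R3}
    (hu : u ∈ tangentSpace x) (hv : v ∈ tangentSpace x) :
    hessian κ ξ x u v = hessian κ ξ x v u := by
  rw [hessian_eq_pairs κ ξ hx hu hv, hessian_eq_pairs κ ξ hx hv hu]
  congr 1
  · congr 1
    refine Finset.sum_congr rfl fun i _ => Finset.sum_congr rfl fun j _ => ?_
    rw [dotProduct_comm (v i) (u i), dotProduct_comm (v j) (u j)]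
    ring
  · exact Finset.sum_congr rfl fun i _ => by rw [dotProduct_comm (v i) (u i)]

/-- `L_N` is skew-symmetric with respect to the Hessian. -/
theorem IsSliceLinearization.hessian_apply_self [DecidableEq ι] {κ : ι → ℝ} {x : ι → R3}
    (hx : x ∈ phaseSpace ι) {ξ : R3} {L : slice κ x →ₗ[ℝ] slice κ x}
    (hL : IsSliceLinearization κ ξ x L) (v : slice κ x) : hessian κ ξ x v (L v) = 0 := by
  have h1 := hL (L v) v
  have h2 := symplecticForm_swap κ x (L v) (L v)
  rw [hessian_symm hx v.2.1 (L v).2.1]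
  linarith

end Slice

/-! ### Quadratic forms and linear flows -/

section Spectral

open scoped TensorProduct

/-- A symmetric form which is diagonalized with positive eigenvalues, relative to an inner product,
by a set of vectors is positive definite on the span of that set. -/
theorem pos_of_mem_span_of_eigenvectors {V : Type*} [AddCommGroup V] [Module ℝ V]
    (T : Submodule ℝ V) (B g : V →ₗ[ℝ] V →ₗ[ℝ] ℝ)
    (hB : ∀ u ∈ T, ∀ v ∈ T, B u v = B v u) (hg : ∀ u v, g u v = g v u)
    (hpos : ∀ v, v ≠ 0 → 0 < g v v) {S : Set V} (hST : S ⊆ T)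
    (hS : ∀ v ∈ S, ∃ c : ℝ, 0 < c ∧ ∀ w ∈ T, B w v = c * g w v) {v : V}
    (hv : v ∈ Submodule.span ℝ S) (hv0 : v ≠ 0) : 0 < B v v := by
  -- Vectors are grouped by eigenvalue, so no independence within `S` is needed: eigenspaces for
  -- distinct values are `g`-orthogonal, and `B` becomes a positive combination of squares.
  let E : {c : ℝ // 0 < c} → Submodule ℝ V := fun c =>
    { carrier := {v | v ∈ T ∧ ∀ w ∈ T, B w v = c * g w v}
      add_mem' := fun {a b} ha hb => ⟨T.add_mem ha.1 hb.1, fun w hw => by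
        rw [map_add, map_add, ha.2 w hw, hb.2 w hw, mul_add]⟩
      zero_mem' := ⟨T.zero_mem, fun w _ => by simp⟩
      smul_mem' := fun r a ha => ⟨T.smul_mem r ha.1, fun w hw => by
        rw [map_smul, map_smul, ha.2 w hw, smul_eq_mul, smul_eq_mul, mul_left_comm]⟩ }
  have hSE : Submodule.span ℝ S ≤ ⨆ c, E c := by
    refine Submodule.span_le.2 fun u hu => ?_
    obtain ⟨c, hc, h⟩ := hS u hu
    exact Submodule.mem_iSup_of_mem (⟨c, hc⟩ : {c : ℝ // 0 < c}) ⟨hST hu, h⟩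
  obtain ⟨f, hf, hsum⟩ := (Submodule.mem_iSup_iff_exists_finsupp E v).1 (hSE hv)
  have horth : ∀ c d, c ≠ d → g (f c) (f d) = 0 := by
    intro c d hcd
    have h1 := (hf d).2 (f c) (hf c).1
    have h2 := (hf c).2 (f d) (hf d).1
    rw [hB _ (hf d).1 _ (hf c).1, h1, hg (f d) (f c)] at h2
    have h3 : ((d : ℝ) - c) * g (f c) (f d) = 0 := by linear_combination h2
    exact (mul_eq_zero.1 h3).resolve_left fun h => hcd (Subtype.ext (sub_eq_zero.1 h).symm)
  have hBv : B v v = ∑ c ∈ f.support, (c : ℝ) * g (f c) (f c) := by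
    rw [← hsum, Finsupp.sum, map_sum]
    refine Finset.sum_congr rfl fun c hc => ?_
    rw [map_sum, LinearMap.sum_apply, Finset.sum_eq_single c]
    · exact (hf c).2 _ (hf c).1
    · intro d _ hd
      rw [(hf c).2 _ (hf d).1, horth d c hd, mul_zero]
    · exact fun h => absurd hc h
  rw [hBv]
  have hne : f.support.Nonempty := by
    rw [Finsupp.support_nonempty_iff]
    rintro rfl
    exact hv0 (by simpa using hsum.symm)
  exact Finset.sum_pos (fun c hc => mul_pos c.2 (hpos _ (Finsupp.mem_support_iff.1 hc))) hne

/-! ### Real and imaginary parts in the complexification; skew endomorphisms -/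

variable {V : Type*} [AddCommMonoid V] [Module ℝ V]

/-- The real part of a vector in the complexification. -/
noncomputable def tensorRe : ℂ ⊗[ℝ] V →ₗ[ℝ] V :=
  (TensorProduct.lid ℝ V).toLinearMap.comp (LinearMap.rTensor V Complex.reLm)

/-- The imaginary part of a vector in the complexification. -/
noncomputable def tensorIm : ℂ ⊗[ℝ] V →ₗ[ℝ] V :=
  (TensorProduct.lid ℝ V).toLinearMap.comp (LinearMap.rTensor V Complex.imLm)

theorem tensorRe_tmul (z : ℂ) (v : V) : tensorRe (z ⊗ₜ[ℝ] v) = z.re • v := by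
  simp [tensorRe]

theorem tensorIm_tmul (z : ℂ) (v : V) : tensorIm (z ⊗ₜ[ℝ] v) = z.im • v := by
  simp [tensorIm]

theorem tensor_eq_re_add_im (x : ℂ ⊗[ℝ] V) :
    x = (1 : ℂ) ⊗ₜ[ℝ] tensorRe x + Complex.I ⊗ₜ[ℝ] tensorIm x := by
  induction x with
  | zero => simp
  | tmul z v =>
    rw [tensorRe_tmul, tensorIm_tmul, TensorProduct.tmul_smul, TensorProduct.tmul_smul,
      TensorProduct.smul_tmul', TensorProduct.smul_tmul', ← TensorProduct.add_tmul]
    congr 1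
    apply Complex.ext <;> simp
  | add x y hx hy =>
    nth_rewrite 1 [hx, hy]
    rw [map_add, map_add, TensorProduct.tmul_add, TensorProduct.tmul_add]
    abel

theorem tensorRe_baseChange (L : V →ₗ[ℝ] V) (x : ℂ ⊗[ℝ] V) :
    tensorRe (L.baseChange ℂ x) = L (tensorRe x) := by
  induction x with
  | zero => simp
  | tmul z v => rw [LinearMap.baseChange_tmul, tensorRe_tmul, tensorRe_tmul, map_smul]
  | add x y hx hy => rw [map_add, map_add, map_add, map_add, hx, hy]

theorem tensorIm_baseChange (L : V →ₗ[ℝ] V) (x : ℂ ⊗[ℝ] V) :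
    tensorIm (L.baseChange ℂ x) = L (tensorIm x) := by
  induction x with
  | zero => simp
  | tmul z v => rw [LinearMap.baseChange_tmul, tensorIm_tmul, tensorIm_tmul, map_smul]
  | add x y hx hy => rw [map_add, map_add, map_add, map_add, hx, hy]

theorem tensorRe_smul (z : ℂ) (x : ℂ ⊗[ℝ] V) :
    tensorRe (z • x) + z.im • tensorIm x = z.re • tensorRe x := by
  induction x with
  | zero => simp
  | tmul w v =>
    rw [TensorProduct.smul_tmul', tensorRe_tmul, tensorRe_tmul, tensorIm_tmul, smul_eq_mul,
      Complex.mul_re, smul_smul, smul_smul, ← add_smul, sub_add_cancel]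
  | add x y hx hy =>
    rw [smul_add, map_add, map_add, map_add, smul_add, smul_add, ← hx, ← hy]
    abel

theorem tensorIm_smul (z : ℂ) (x : ℂ ⊗[ℝ] V) :
    tensorIm (z • x) = z.im • tensorRe x + z.re • tensorIm x := by
  induction x with
  | zero => simp
  | tmul w v =>
    rw [TensorProduct.smul_tmul', tensorIm_tmul, tensorRe_tmul, tensorIm_tmul, smul_eq_mul,
      Complex.mul_im, add_smul, mul_smul, mul_smul, add_comm]
  | add x y hx hy => rw [smul_add, map_add, map_add, map_add, hx, hy, smul_add, smul_add]; abel

theorem hasEigenvalue_baseChange_of_apply_eq {V : Type*} [AddCommGroup V] [Module ℝ V]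
    {L : V →ₗ[ℝ] V} {v : V} (hv : v ≠ 0) {r : ℝ} (h : L v = r • v) : Module.End.HasEigenvalue (L.baseChange ℂ) (r : ℂ) := by
  refine Module.End.hasEigenvalue_of_hasEigenvector (x := (1 : ℂ) ⊗ₜ[ℝ] v)
    ⟨Module.End.mem_eigenspace_iff.2 ?_, fun h0 => hv ?_⟩
  · rw [LinearMap.baseChange_tmul, h, TensorProduct.tmul_smul, TensorProduct.smul_tmul',
      TensorProduct.smul_tmul']
    simp
  · simpa [tensorRe_tmul] using congrArg tensorRe h0

/-- An endomorphism that is skew with respect to a positive definite form has purely imaginary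
eigenvalues. -/
theorem re_eq_zero_of_skew {L : V →ₗ[ℝ] V} (B : V →ₗ[ℝ] V →ₗ[ℝ] ℝ)
    (hsymm : ∀ u v, B u v = B v u) (hpos : ∀ v, v ≠ 0 → 0 < B v v) (hskew : ∀ v, B v (L v) = 0)
    {z : ℂ} (hz : Module.End.HasEigenvalue (L.baseChange ℂ) z) : z.re = 0 := by
  obtain ⟨e, he⟩ := hz.exists_hasEigenvector
  have h := Module.End.mem_eigenspace_iff.1 he.1
  set x := tensorRe e with hx
  set y := tensorIm e with hy
  have h1 : L x + z.im • y = z.re • x := by rw [hx, ← tensorRe_baseChange, h, tensorRe_smul]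
  have h2 : L y = z.im • x + z.re • y := by rw [hy, ← tensorIm_baseChange, h, tensorIm_smul]
  have h3 := congrArg (B x) h1
  have h4 := hskew y
  rw [map_add, map_smul, map_smul, smul_eq_mul, smul_eq_mul, hskew] at h3
  rw [h2, map_add, map_smul, map_smul, smul_eq_mul, smul_eq_mul, hsymm y x] at h4
  have hnn : ∀ v, 0 ≤ B v v := fun v => by
    by_cases hv : v = 0
    · simp [hv]
    · exact (hpos v hv).le
  have hxy : 0 < B x x + B y y := by
    by_cases hx0 : x = 0
    · by_cases hy0 : y = 0
      · exact absurd (by rw [tensor_eq_re_add_im e, ← hx, ← hy, hx0, hy0]; simp) he.2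
      · linarith [hnn x, hpos y hy0]
    · linarith [hpos x hx0, hnn y]
  -- For the eigenvector `x + i y`, pairing `L x` with `x` and `L y` with `y` gives `0` on both; the
  -- mixed terms `z.im * B x y` cancel by symmetry.
  have h5 : z.re * (B x x + B y y) = 0 := by linear_combination h4 - h3
  exact (mul_eq_zero.1 h5).resolve_right hxy.ne'

/-- A linear flow that is skew with respect to a positive definite form has bounded orbits. -/
theorem exists_norm_le_of_skew {V : Type*} [NormedAddCommGroup V] [NormedSpace ℝ V]
    [FiniteDimensional ℝ V] {L : V →ₗ[ℝ] V} (B : V →ₗ[ℝ] V →ₗ[ℝ] ℝ)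
    (hsymm : ∀ u v, B u v = B v u) (hpos : ∀ v, v ≠ 0 → 0 < B v v) (hskew : ∀ v, B v (L v) = 0)
    {v : ℝ → V} (hv : ∀ t, HasDerivAt v (L (v t)) t) : ∃ C : ℝ, ∀ t, ‖v t‖ ≤ C := by
  have : ProperSpace V := FiniteDimensional.proper_real V
  let B' : V →L[ℝ] V →L[ℝ] ℝ :=
    LinearMap.toContinuousLinearMap (LinearMap.toContinuousLinearMap.toLinearMap.comp B)
  have hB' : ∀ u w, B' u w = B u w := fun u w => rfl
  have hderiv : ∀ t, HasDerivAt (fun t => B' (v t) (v t)) 0 t := fun t => by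
    have h1 : HasDerivAt (fun t => B' (v t)) (B' (L (v t))) t :=
      B'.hasFDerivAt.comp_hasDerivAt t (hv t)
    refine (h1.clm_apply (hv t)).congr_deriv ?_
    rw [hB', hB', hsymm, hskew, add_zero]
  have hconst : ∀ t, B' (v t) (v t) = B' (v 0) (v 0) := fun t =>
    is_const_of_deriv_eq_zero (fun t => (hderiv t).differentiableAt) (fun t => (hderiv t).deriv) t 0
  -- `B (v t) (v t)` is conserved; a lower bound by the norm, from compactness of the unit sphere,
  -- makes the orbit bounded. An empty sphere means `V = 0`.
  obtain ⟨m, hm0, hm⟩ : ∃ m : ℝ, 0 < m ∧ ∀ u : V, m * ‖u‖ ^ 2 ≤ B' u u := by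
    have hcont : Continuous fun u : V => B' u u := by fun_prop
    by_cases hne : (Metric.sphere (0 : V) 1).Nonempty
    · obtain ⟨u₀, hu₀, hmin⟩ := (isCompact_sphere (0 : V) 1).exists_isMinOn hne hcont.continuousOn
      refine ⟨B' u₀ u₀, hpos u₀ (fun h => by simp [h] at hu₀), fun u => ?_⟩
      by_cases hu : u = 0
      · simp [hu]
      have hn : ‖u‖ ≠ 0 := norm_ne_zero_iff.2 hu
      have h1 : ‖u‖⁻¹ • u ∈ Metric.sphere (0 : V) 1 := by
        simp [norm_smul, hn]
      have h2 := isMinOn_iff.1 hmin _ h1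
      simp only [map_smul, smul_apply, smul_eq_mul] at h2
      calc B' u₀ u₀ * ‖u‖ ^ 2 ≤ (‖u‖⁻¹ * (‖u‖⁻¹ * B' u u)) * ‖u‖ ^ 2 := by gcongr
        _ = B' u u := by field_simp
    · refine ⟨1, one_pos, fun u => ?_⟩
      have hu : u = 0 := by
        by_contra hu
        exact hne ⟨‖u‖⁻¹ • u, by simp [norm_smul, norm_ne_zero_iff.2 hu]⟩
      simp [hu]
  refine ⟨Real.sqrt (B' (v 0) (v 0) / m), fun t => Real.le_sqrt_of_sq_le ?_⟩
  rw [le_div_iff₀ hm0, ← hconst t, mul_comm]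
  exact hm _

end Spectral

/-! ### Trigonometric sums over a regular polygon -/

/-- Subtraction in `Fin n` is modulo `n`, so longitudes are additive only up to full turns. -/
theorem longitude_sub (n : ℕ) (s t : Fin n) :
    ∃ m : ℤ, longitude n (s - t) = longitude n s - longitude n t + m * (2 * Real.pi) := by
  have hn : (n : ℝ) ≠ 0 := by
    have := s.pos
    positivity
  have h := Nat.div_add_mod (n - (t : ℕ) + s) n
  have h2 : ((s - t : Fin n) : ℕ) = (n - (t : ℕ) + s) % n := Fin.sub_def s t ▸ rfl
  rw [← h2] at h
  generalize (n - (t : ℕ) + s) / n = q at h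
  refine ⟨1 - q, ?_⟩
  have h3 := congrArg (Nat.cast : ℕ → ℝ) h
  push_cast [t.2.le] at h3
  simp only [longitude]
  push_cast [t.2.le]
  field_simp
  linear_combination h3

theorem longitude_add (n : ℕ) (s t : Fin n) :
    ∃ m : ℤ, longitude n (s + t) = longitude n s + longitude n t + m * (2 * Real.pi) := by
  have hn : (n : ℝ) ≠ 0 := by
    have := s.pos
    positivity
  have h := Nat.div_add_mod ((s : ℕ) + t) n
  rw [← Fin.val_add] at h
  generalize ((s : ℕ) + t) / n = q at h
  refine ⟨-q, ?_⟩
  have h3 := congrArg (Nat.cast : ℕ → ℝ) h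
  push_cast at h3
  simp only [longitude]
  push_cast
  field_simp
  linear_combination h3

/-- Odd periodic functions have zero sum over the polygon. -/
theorem sum_odd_longitude (n : ℕ) (s : Fin n) {h : ℝ → ℝ} (hodd : ∀ x, h (-x) = -h x)
    (hper : Function.Periodic h (2 * Real.pi)) :
    ∑ t, h (longitude n t - longitude n s) = 0 := by
  have : NeZero n := ⟨s.pos.ne'⟩
  -- The reflection `t ↦ 2 s - t` of the polygon permutes the vertices and reverses longitudes
  -- relative to `s`.
  have h1 : ∀ t, h (longitude n (s + s - t) - longitude n s) =
      -h (longitude n t - longitude n s) := by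
    intro t
    obtain ⟨a, ha⟩ := longitude_sub n (s + s) t
    obtain ⟨b, hb⟩ := longitude_add n s s
    rw [ha, hb, ← hodd, ← hper.int_mul (a + b) (-_)]
    congr 1
    push_cast
    ring
  have h2 := (Equiv.subLeft (s + s)).sum_comp fun t => h (longitude n t - longitude n s)
  simp only [Equiv.subLeft_apply, h1, Finset.sum_neg_distrib] at h2
  linarith

theorem sum_cos_longitude {n l : ℕ} (hl : 0 < l) (hln : l < n) (d : ℝ) :
    ∑ t, Real.cos (l * longitude n t + d) = 0 := by
  have hn : (n : ℝ) ≠ 0 := by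
    have := hl.trans hln
    positivity
  -- Half the angular step: multiplication by `2 sin a` makes the sum telescope, and `0 < l < n`
  -- ensures `sin a ≠ 0`.
  set a : ℝ := l * Real.pi / n with ha
  have hsin : Real.sin a ≠ 0 := by
    refine (Real.sin_pos_of_pos_of_lt_pi (by positivity) ?_).ne'
    rw [ha, div_lt_iff₀ (by positivity), mul_comm]
    have : (l : ℝ) < n := by exact_mod_cast hln
    gcongr
  have h1 : ∑ t : Fin n, Real.cos (l * longitude n t + d) =
      ∑ k ∈ Finset.range n, Real.cos (2 * a * k + d) := by
    rw [← Fin.sum_univ_eq_sum_range (fun k => Real.cos (2 * a * k + d))]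
    refine Finset.sum_congr rfl fun t _ => ?_
    rw [longitude, ha]
    congr 2
    ring
  have h2 : ∀ k : ℕ, 2 * Real.sin a * Real.cos (2 * a * k + d) =
      Real.sin (2 * a * ((k + 1 : ℕ) : ℝ) + d - a) - Real.sin (2 * a * k + d - a) := by
    intro k
    have e1 : 2 * a * ((k + 1 : ℕ) : ℝ) + d - a = (2 * a * k + d) + a := by push_cast; ring
    rw [e1, Real.sin_add, Real.sin_sub]
    ring
  have h3 : 2 * Real.sin a * ∑ k ∈ Finset.range n, Real.cos (2 * a * k + d) = 0 := by
    rw [Finset.mul_sum, Finset.sum_congr rfl fun k _ => h2 k,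
      Finset.sum_range_sub (fun k : ℕ => Real.sin (2 * a * k + d - a))]
    have e : 2 * a * (n : ℝ) + d - a = (2 * a * ((0 : ℕ) : ℝ) + d - a) + l * (2 * Real.pi) := by
      rw [ha]
      field_simp
      push_cast
      ring
    rw [e, Real.sin_add_nat_mul_two_pi, sub_self]
  rw [h1]
  exact (mul_eq_zero.1 h3).resolve_left (mul_ne_zero two_ne_zero hsin)

/-- Two longitudes in `[0, 2π)` differ by strictly less than a full turn. -/
theorem one_sub_cos_longitude_ne_zero {n : ℕ} {s t : Fin n} (hst : t ≠ s) :
    1 - Real.cos (longitude n t - longitude n s) ≠ 0 := by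
  have hn : (0 : ℝ) < n := by exact_mod_cast s.pos
  have hlt : ∀ r : Fin n, 0 ≤ longitude n r ∧ longitude n r < 2 * Real.pi := fun r => by
    have hr : ((r : ℕ) : ℝ) < n := by exact_mod_cast r.2
    refine ⟨by unfold longitude; positivity, ?_⟩
    rw [longitude, div_lt_iff₀ hn]
    gcongr
  intro h
  have h1 := (Real.cos_eq_one_iff_of_lt_of_lt (by linarith [(hlt t).1, (hlt s).2])
    (by linarith [(hlt s).1, (hlt t).2])).1 (sub_eq_zero.1 h).symm
  apply hst
  have h2 : 2 * Real.pi * ((t : ℕ) : ℝ) / n = 2 * Real.pi * ((s : ℕ) : ℝ) / n := sub_eq_zero.1 h1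
  have h3 : ((t : ℕ) : ℝ) = s := by
    have := Real.pi_ne_zero
    field_simp at h2
    exact h2
  exact Fin.ext (by exact_mod_cast h3)

theorem sum_erase_one {n : ℕ} (s : Fin n) : ∑ _t ∈ Finset.univ.erase s, (1 : ℝ) = n - 1 := by
  have := s.pos
  simp [Finset.card_erase_of_mem, Nat.cast_sub (show 1 ≤ n from this)]

/-- `∑ sin (l φ) / (1 - cos φ) = 0`, the sum over the differences of longitude. -/
theorem sum_sin_div (n l : ℕ) (s : Fin n) :
    ∑ t ∈ Finset.univ.erase s, Real.sin (l * (longitude n t - longitude n s)) /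
      (1 - Real.cos (longitude n t - longitude n s)) = 0 := by
  have h := sum_odd_longitude n s (h := fun x => Real.sin (l * x) / (1 - Real.cos x))
    (fun x => by simp [neg_div]) (fun x => by
      simp only [Real.cos_add_two_pi, mul_add, Real.sin_add_nat_mul_two_pi])
  -- The vertex `t = s` contributes `sin 0 / 0 = 0`, so it may be restored.
  rwa [← Finset.add_sum_erase _ _ (Finset.mem_univ s), sub_self, mul_zero, Real.sin_zero, zero_div,
    zero_add] at h

/-- `∑ (1 - cos (l φ)) / (1 - cos φ) = l (n - l)`, the sum over the differences of longitude. -/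
theorem sum_one_sub_cos_div {n : ℕ} (s : Fin n) {l : ℕ} (hl : l ≤ n) :
    ∑ t ∈ Finset.univ.erase s, (1 - Real.cos (l * (longitude n t - longitude n s))) /
      (1 - Real.cos (longitude n t - longitude n s)) = l * (n - l) := by
  -- From `cos ((l+2)x) + cos (lx) = 2 cos x cos ((l+1)x)`, the second difference of the summands in
  -- `l` is `2 cos ((l+1)x)`. Its sum over `t ≠ s` is `-2`, which is also the second difference of
  -- `l (n - l)`.
  induction l using Nat.strong_induction_on with
  | _ l ih =>
  match l, ih, hl with
  | 0, _, _ => simp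
  | 1, _, _ =>
    rw [Nat.cast_one, one_mul, ← sum_erase_one s]
    refine Finset.sum_congr rfl fun t ht => ?_
    rw [one_mul, div_self (one_sub_cos_longitude_ne_zero (Finset.ne_of_mem_erase ht))]
  | l + 2, ih, hl =>
    have h0 := ih l (by omega) (by omega)
    have h1 := ih (l + 1) (by omega) (by omega)
    have h2 : ∑ t ∈ Finset.univ.erase s,
        Real.cos ((l + 1 : ℕ) * (longitude n t - longitude n s)) = -1 := by
      have h := sum_cos_longitude (n := n) (l := l + 1) (by omega) (by omega)
        (-((l + 1 : ℕ) * longitude n s))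
      simp only [← sub_eq_add_neg, ← mul_sub] at h
      rw [← Finset.add_sum_erase _ _ (Finset.mem_univ s), sub_self, mul_zero, Real.cos_zero] at h
      linarith
    have h3 : ∀ t ∈ Finset.univ.erase s,
        (1 - Real.cos ((l + 2 : ℕ) * (longitude n t - longitude n s))) /
          (1 - Real.cos (longitude n t - longitude n s)) =
        2 * ((1 - Real.cos ((l + 1 : ℕ) * (longitude n t - longitude n s))) /
          (1 - Real.cos (longitude n t - longitude n s))) -
        (1 - Real.cos (l * (longitude n t - longitude n s))) /
          (1 - Real.cos (longitude n t - longitude n s)) +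
        2 * Real.cos ((l + 1 : ℕ) * (longitude n t - longitude n s)) := by
      intro t ht
      have hne := one_sub_cos_longitude_ne_zero (Finset.ne_of_mem_erase ht)
      set x := longitude n t - longitude n s
      have e1 : ((l + 2 : ℕ) : ℝ) * x = (l + 1 : ℕ) * x + x := by push_cast; ring
      have e2 : (l : ℝ) * x = (l + 1 : ℕ) * x - x := by push_cast; ring
      rw [e1, e2, Real.cos_add _ x, Real.cos_sub _ x]
      field_simp
      ring
    rw [Finset.sum_congr rfl h3, Finset.sum_add_distrib, Finset.sum_sub_distrib, ← Finset.mul_sum,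
      ← Finset.mul_sum, h0, h1, h2]
    push_cast
    ring

/-- The Fourier modes are eigenvectors of the difference operator with kernel
`1 / (1 - cos φ)`. -/
theorem sum_mode_sub_div {n : ℕ} (s : Fin n) {l : ℕ} (hl : l ≤ n) (d : ℝ) :
    ∑ t ∈ Finset.univ.erase s,
      (Real.cos (l * longitude n s + d) - Real.cos (l * longitude n t + d)) /
      (1 - Real.cos (longitude n t - longitude n s)) =
        l * (n - l) * Real.cos (l * longitude n s + d) := by
  -- Expand around the vertex `s`: the cosine part gives the eigenvalue, the sine part is odd and
  -- sums to zero.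
  have h : ∀ t, (Real.cos (l * longitude n s + d) - Real.cos (l * longitude n t + d)) /
      (1 - Real.cos (longitude n t - longitude n s)) =
      (1 - Real.cos (l * (longitude n t - longitude n s))) /
        (1 - Real.cos (longitude n t - longitude n s)) * Real.cos (l * longitude n s + d) +
      Real.sin (l * (longitude n t - longitude n s)) /
        (1 - Real.cos (longitude n t - longitude n s)) * Real.sin (l * longitude n s + d) := by
    intro t
    have e : l * longitude n t + d =
      (l * longitude n s + d) + l * (longitude n t - longitude n s) := by ring
    rw [e, Real.cos_add (_ + d)]
    ring
  simp only [h, Finset.sum_add_distrib, ← Finset.sum_mul]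
  rw [sum_one_sub_cos_div s hl, sum_sin_div]
  ring

/-! ### The ring with two polar vortices -/

section Ring

open Real (sin cos)

/-- The point of the unit sphere with co-latitude `θ` and longitude `α`. -/
noncomputable def spherePoint (θ α : ℝ) : R3 := ![sin θ * cos α, sin θ * sin α, cos θ]

/-- The unit tangent vector in the direction of the meridian. -/
noncomputable def meridian (θ α : ℝ) : R3 := ![cos θ * cos α, cos θ * sin α, -sin θ]

/-- The unit tangent vector in the direction of the parallel. -/
noncomputable def parallel (α : ℝ) : R3 := ![-sin α, cos α, 0]

/-- The North pole. -/
def northPole : R3 := ![0, 0, 1]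

variable {n : ℕ} {θ κN κS : ℝ}

@[simp] theorem ringConfig_inl (s : Fin n) :
    ringConfig n θ (Sum.inl s) = spherePoint θ (longitude n s) := rfl

@[simp] theorem ringConfig_north : ringConfig n θ (Sum.inr 0) = northPole := rfl

@[simp] theorem ringConfig_south : ringConfig n θ (Sum.inr 1) = -northPole := by
  simp [ringConfig, northPole]

@[simp] theorem ringVorticity_inl (s : Fin n) : ringVorticity n κN κS (Sum.inl s) = 1 := rfl

@[simp] theorem ringVorticity_north : ringVorticity n κN κS (Sum.inr 0) = κN := rfl

@[simp] theorem ringVorticity_south : ringVorticity n κN κS (Sum.inr 1) = κS := rfl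

@[simp] theorem thetaVariation_inl (a : Fin n → ℝ) (s : Fin n) :
    thetaVariation n θ a (Sum.inl s) = a s • meridian θ (longitude n s) := rfl

@[simp] theorem thetaVariation_inr (a : Fin n → ℝ) (k : Fin 2) :
    thetaVariation n θ a (Sum.inr k) = 0 := rfl

@[simp] theorem phiVariation_inl (a : Fin n → ℝ) (s : Fin n) :
    phiVariation n θ a (Sum.inl s) = (a s * sin θ) • parallel (longitude n s) := by
  simp [phiVariation, parallel, mul_assoc]

@[simp] theorem phiVariation_inr (a : Fin n → ℝ) (k : Fin 2) :
    phiVariation n θ a (Sum.inr k) = 0 := rfl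

theorem sum_erase_inl (f : Fin n ⊕ Fin 2 → ℝ) (s : Fin n) :
    ∑ j ∈ Finset.univ.erase (Sum.inl s), f j =
      ∑ t ∈ Finset.univ.erase s, f (Sum.inl t) + f (Sum.inr 0) + f (Sum.inr 1) := by
  rw [Finset.sum_erase_eq_sub (Finset.mem_univ _), Finset.sum_erase_eq_sub (Finset.mem_univ _),
    Fintype.sum_sum_type, Fin.sum_univ_two]
  ring

theorem sum_erase_north (f : Fin n ⊕ Fin 2 → ℝ) :
    ∑ j ∈ Finset.univ.erase (Sum.inr 0), f j = ∑ t, f (Sum.inl t) + f (Sum.inr 1) := by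
  rw [Finset.sum_erase_eq_sub (Finset.mem_univ _), Fintype.sum_sum_type, Fin.sum_univ_two]
  ring

theorem sum_erase_south (f : Fin n ⊕ Fin 2 → ℝ) :
    ∑ j ∈ Finset.univ.erase (Sum.inr 1), f j = ∑ t, f (Sum.inl t) + f (Sum.inr 0) := by
  rw [Finset.sum_erase_eq_sub (Finset.mem_univ _), Fintype.sum_sum_type, Fin.sum_univ_two]
  ring

/-! ### Inner products in the frame of meridians and parallels -/

theorem spherePoint_dot_spherePoint (θ α β : ℝ) :
    spherePoint θ α ⬝ᵥ spherePoint θ β = 1 - sin θ ^ 2 * (1 - cos (β - α)) := by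
  simp only [spherePoint, Matrix.vec3_dotProduct', Real.cos_sub]
  linear_combination Real.sin_sq_add_cos_sq θ

theorem meridian_dot_spherePoint (θ α β : ℝ) :
    meridian θ α ⬝ᵥ spherePoint θ β = -(sin θ * cos θ * (1 - cos (β - α))) := by
  simp only [spherePoint, meridian, Matrix.vec3_dotProduct', Real.cos_sub]
  ring

theorem spherePoint_dot_meridian (θ α β : ℝ) :
    spherePoint θ α ⬝ᵥ meridian θ β = -(sin θ * cos θ * (1 - cos (β - α))) := by
  simp only [spherePoint, meridian, Matrix.vec3_dotProduct', Real.cos_sub]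
  ring

theorem parallel_dot_spherePoint (θ α β : ℝ) :
    parallel α ⬝ᵥ spherePoint θ β = sin θ * sin (β - α) := by
  simp only [spherePoint, parallel, Matrix.vec3_dotProduct', Real.sin_sub]
  ring

theorem spherePoint_dot_parallel (θ α β : ℝ) :
    spherePoint θ α ⬝ᵥ parallel β = -(sin θ * sin (β - α)) := by
  simp only [spherePoint, parallel, Matrix.vec3_dotProduct', Real.sin_sub]
  ring

theorem spherePoint_dot_northPole (θ α : ℝ) : spherePoint θ α ⬝ᵥ northPole = cos θ := by
  simp [spherePoint, northPole]

theorem meridian_dot_northPole (θ α : ℝ) : meridian θ α ⬝ᵥ northPole = -sin θ := by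
  simp [meridian, northPole]

theorem parallel_dot_northPole (α : ℝ) : parallel α ⬝ᵥ northPole = 0 := by
  simp [parallel, northPole]

theorem northPole_dot_self : northPole ⬝ᵥ northPole = 1 := by
  simp [northPole]

theorem meridian_dot_meridian (θ α β : ℝ) :
    meridian θ α ⬝ᵥ meridian θ β = 1 - cos θ ^ 2 * (1 - cos (β - α)) := by
  simp only [meridian, Matrix.vec3_dotProduct', Real.cos_sub]
  linear_combination Real.sin_sq_add_cos_sq θ

theorem meridian_dot_parallel (θ α β : ℝ) :
    meridian θ α ⬝ᵥ parallel β = -(cos θ * sin (β - α)) := by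
  simp only [meridian, parallel, Matrix.vec3_dotProduct', Real.sin_sub]
  ring

theorem parallel_dot_meridian (θ α β : ℝ) :
    parallel α ⬝ᵥ meridian θ β = cos θ * sin (β - α) := by
  simp only [meridian, parallel, Matrix.vec3_dotProduct', Real.sin_sub]
  ring

theorem parallel_dot_parallel (α β : ℝ) : parallel α ⬝ᵥ parallel β = cos (β - α) := by
  simp only [parallel, Matrix.vec3_dotProduct', Real.cos_sub]
  ring

/-- A tangent vector of the sphere in the orthonormal frame. -/
theorem eq_meridian_add_parallel {θ α : ℝ} {w : R3} (hw : spherePoint θ α ⬝ᵥ w = 0) :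
    w = (w ⬝ᵥ meridian θ α) • meridian θ α + (w ⬝ᵥ parallel α) • parallel α := by
  simp only [spherePoint, Matrix.vec3_dotProduct, Matrix.cons_val] at hw
  have h1 := Real.sin_sq_add_cos_sq θ
  have h2 := Real.sin_sq_add_cos_sq α
  ext k
  fin_cases k <;> simp only [Pi.add_apply, Pi.smul_apply, smul_eq_mul, meridian, parallel,
    Matrix.vec3_dotProduct, Matrix.cons_val, Fin.zero_eta, Fin.mk_one, Fin.reduceFinMk]
  · linear_combination (sin θ * cos α) * hw - (w 0 * cos α ^ 2 + w 1 * sin α * cos α) * h1 -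
      w 0 * h2
  · linear_combination (sin θ * sin α) * hw - (w 1 * sin α ^ 2 + w 0 * sin α * cos α) * h1 -
      w 1 * h2
  · linear_combination (cos θ) * hw - w 2 * h1

theorem one_sub_cos_ne_zero (h : sin θ ≠ 0) : 1 - cos θ ≠ 0 := fun h0 => h (by
  have := Real.sin_sq_add_cos_sq θ
  have hc : cos θ = 1 := by linarith
  rw [hc] at this
  exact pow_eq_zero_iff (two_ne_zero) |>.1 (by linarith))

theorem one_add_cos_ne_zero (h : sin θ ≠ 0) : 1 + cos θ ≠ 0 := fun h0 => h (by
  have := Real.sin_sq_add_cos_sq θ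
  have hc : cos θ = -1 := by linarith
  rw [hc] at this
  exact pow_eq_zero_iff (two_ne_zero) |>.1 (by linarith))

/-! ### The ring as a relative equilibrium -/

theorem ringConfig_mem_phaseSpace (hθ : sin θ ≠ 0) :
    ringConfig n θ ∈ phaseSpace (Fin n ⊕ Fin 2) := by
  have hunit : ∀ i, ringConfig n θ i ⬝ᵥ ringConfig n θ i = 1 := by
    rintro (s | k)
    · simp [spherePoint_dot_spherePoint]
    · fin_cases k <;> simp [northPole_dot_self]
  refine ⟨hunit, fun i j hij h => ?_⟩
  have hd : 1 - ringConfig n θ i ⬝ᵥ ringConfig n θ j = 0 := by rw [← h, hunit, sub_self]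
  revert hd
  have h1 := one_sub_cos_ne_zero hθ
  have h2 := one_add_cos_ne_zero hθ
  rcases i with s | k
  · rcases j with t | k
    · have h3 := one_sub_cos_longitude_ne_zero (n := n) (s := s) (t := t)
        (fun h => hij (by rw [h]))
      simp [spherePoint_dot_spherePoint, hθ, h3]
    · fin_cases k <;> simp [spherePoint_dot_northPole, h1, h2]
  · rcases j with t | l
    · fin_cases k <;> simp [dotProduct_comm northPole, spherePoint_dot_northPole, h1, h2]
    · fin_cases k <;> fin_cases l <;> simp [northPole_dot_self] at hij ⊢

theorem ringVorticity_ne_zero (hN : κN ≠ 0) (hS : κS ≠ 0) (i : Fin n ⊕ Fin 2) :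
    ringVorticity n κN κS i ≠ 0 := by
  rcases i with s | k
  · simp
  · fin_cases k <;> simp [hN, hS]

/-- The vertical component of the angular velocity of the relative equilibrium. -/
noncomputable def ringAngularSpeed (n : ℕ) (θ κN κS : ℝ) : ℝ :=
  ((n - 1) * cos θ + κN * (1 + cos θ) - κS * (1 - cos θ)) / sin θ ^ 2

theorem sum_longitude_cos (hn : 2 ≤ n) : ∑ t, cos (longitude n t) = 0 := by
  simpa using sum_cos_longitude (n := n) (l := 1) one_pos (by omega) 0

theorem sum_longitude_sin (hn : 2 ≤ n) : ∑ t, sin (longitude n t) = 0 := by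
  simpa [← sub_eq_add_neg, Real.cos_sub_pi_div_two] using
    sum_cos_longitude (n := n) (l := 1) one_pos (by omega) (-(Real.pi / 2))

theorem sum_spherePoint (hn : 2 ≤ n) :
    ∑ t, spherePoint θ (longitude n t) = (n * cos θ) • northPole := by
  ext k
  fin_cases k <;>
    simp [spherePoint, northPole, Finset.sum_apply, ← Finset.mul_sum, sum_longitude_cos hn,
      sum_longitude_sin hn]

theorem momentum_ring (hn : 2 ≤ n) :
    momentum (ringVorticity n κN κS) (ringConfig n θ) = (n * cos θ + κN - κS) • northPole := by
  simp [momentum, sum_spherePoint hn, add_smul, sub_smul]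
  abel

theorem div_one_sub_cos (h : sin θ ≠ 0) (a : ℝ) :
    a / (1 - cos θ) = a * (1 + cos θ) / sin θ ^ 2 := by
  rw [div_eq_div_iff (one_sub_cos_ne_zero h) (pow_ne_zero 2 h)]
  linear_combination a * Real.sin_sq_add_cos_sq θ

theorem div_one_add_cos (h : sin θ ≠ 0) (a : ℝ) :
    a / (1 + cos θ) = a * (1 - cos θ) / sin θ ^ 2 := by
  rw [div_eq_div_iff (one_add_cos_ne_zero h) (pow_ne_zero 2 h)]
  linear_combination a * Real.sin_sq_add_cos_sq θ

/-- The equilibrium condition at a vortex of the ring. -/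
theorem ring_balance (hθ : sin θ ≠ 0) (s : Fin n) {w : R3}
    (hw : spherePoint θ (longitude n s) ⬝ᵥ w = 0) :
    w ⬝ᵥ (∑ j ∈ Finset.univ.erase (Sum.inl s), (ringVorticity n κN κS j /
      (1 - ringConfig n θ (Sum.inl s) ⬝ᵥ ringConfig n θ j)) • ringConfig n θ j -
      ringAngularSpeed n θ κN κS • northPole) = 0 := by
  have h1 := one_sub_cos_ne_zero hθ
  have h2 := one_add_cos_ne_zero hθ
  have hN : w ⬝ᵥ northPole = -(sin θ * w ⬝ᵥ meridian θ (longitude n s)) := by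
    conv_lhs => rw [eq_meridian_add_parallel hw]
    simp [meridian_dot_northPole, parallel_dot_northPole, mul_comm]
  set p := w ⬝ᵥ meridian θ (longitude n s) with hp
  set q := w ⬝ᵥ parallel (longitude n s) with hq
  -- Each ring vortex exerts a meridional part independent of `t` and an odd part along the
  -- parallel; the latter cancels over the ring. The factor `(1 : ℕ)` and the `* 1` match
  -- `sum_sin_div` and `sum_erase_one`.
  have hpair : ∀ t ∈ Finset.univ.erase s, w ⬝ᵥ ((ringVorticity n κN κS (Sum.inl t) /
      (1 - ringConfig n θ (Sum.inl s) ⬝ᵥ ringConfig n θ (Sum.inl t))) •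
        ringConfig n θ (Sum.inl t)) =
      -(cos θ * p / sin θ) * 1 + q / sin θ * (sin ((1 : ℕ) * (longitude n t - longitude n s)) /
        (1 - cos (longitude n t - longitude n s))) := by
    intro t ht
    have hne := one_sub_cos_longitude_ne_zero (Finset.ne_of_mem_erase ht)
    have hwt : w ⬝ᵥ spherePoint θ (longitude n t) =
        p * -(sin θ * cos θ * (1 - cos (longitude n t - longitude n s))) +
        q * (sin θ * sin (longitude n t - longitude n s)) := by
      conv_lhs => rw [eq_meridian_add_parallel hw]
      simp only [add_dotProduct, smul_dotProduct, smul_eq_mul, meridian_dot_spherePoint,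
        parallel_dot_spherePoint, hp, hq]
    simp only [ringConfig_inl, ringVorticity_inl, dotProduct_smul, smul_eq_mul, hwt,
      spherePoint_dot_spherePoint, Nat.cast_one, one_mul]
    field_simp
    ring
  rw [dotProduct_sub, dotProduct_sum, sum_erase_inl, Finset.sum_congr rfl hpair,
    Finset.sum_add_distrib, ← Finset.mul_sum, ← Finset.mul_sum, sum_erase_one, sum_sin_div]
  simp only [ringConfig_inl, ringConfig_north, ringConfig_south, ringVorticity_north,
    ringVorticity_south, dotProduct_smul, dotProduct_neg, spherePoint_dot_northPole, hN,
    smul_eq_mul, sub_neg_eq_add, ringAngularSpeed, div_one_sub_cos hθ, div_one_add_cos hθ]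
  field_simp
  ring

/-- At a pole the ring sums to a vertical vector, the other pole and `ξ` are vertical too, and
tangent vectors are horizontal. At the ring, `ring_balance` fixes the speed. -/
theorem isRelativeEquilibrium_ring (hn : 2 ≤ n) (hθ : sin θ ≠ 0) :
    IsRelativeEquilibrium (ringVorticity n κN κS) (ringConfig n θ)
      (ringAngularSpeed n θ κN κS • northPole) := by
  have hx := ringConfig_mem_phaseSpace (n := n) hθ
  refine ⟨hx, fun u hu => ?_⟩
  rw [fderiv_augmented_radial_of_tangent _ _ hx hu]
  refine Finset.sum_eq_zero fun i _ => ?_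
  rw [mul_eq_zero]
  right
  rcases i with s | k
  · exact ring_balance hθ s (hu (Sum.inl s))
  · have hsum : u (Sum.inr k) ⬝ᵥ northPole = 0 →
        ∑ t, u (Sum.inr k) ⬝ᵥ spherePoint θ (longitude n t) = 0 := fun h => by
      rw [← dotProduct_sum, sum_spherePoint hn, dotProduct_smul, h, smul_zero]
    have hu := hu (Sum.inr k)
    fin_cases k
    · have h : u (Sum.inr 0) ⬝ᵥ northPole = 0 := by simpa [dotProduct_comm] using hu
      simp only [Fin.zero_eta, dotProduct_sub, dotProduct_sum, sum_erase_north]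
      simp [h, dotProduct_comm northPole (spherePoint _ _), spherePoint_dot_northPole,
        ← Finset.mul_sum]
      exact Or.inr (hsum h)
    · have h : u (Sum.inr 1) ⬝ᵥ northPole = 0 := by simpa [dotProduct_comm] using hu
      simp only [Fin.mk_one, dotProduct_sub, dotProduct_sum, sum_erase_south]
      simp [h, dotProduct_comm northPole (spherePoint _ _), spherePoint_dot_northPole,
        ← Finset.mul_sum]
      exact Or.inr (hsum h)

/-- The difference of two angular velocities is orthogonal to every tangent plane. The plane at the
North pole (where `κN ≠ 0` is cancelled) kills its horizontal part, and the meridian at one ring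
vortex kills its vertical part. -/
theorem existsUnique_angularVelocity (hn : 2 ≤ n) (hθ : sin θ ≠ 0) (hN : κN ≠ 0) :
    ∃! ξ, IsRelativeEquilibrium (ringVorticity n κN κS) (ringConfig n θ) ξ := by
  refine ⟨_, isRelativeEquilibrium_ring hn hθ, fun ξ hξ => ?_⟩
  have hx := ringConfig_mem_phaseSpace (n := n) hθ
  have key : ∀ i, ∀ z : R3, ringConfig n θ i ⬝ᵥ z = 0 → ringVorticity n κN κS i *
      (z ⬝ᵥ (ξ - ringAngularSpeed n θ κN κS • northPole)) = 0 := by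
    intro i z hz
    have hT : (Pi.single i z : Fin n ⊕ Fin 2 → R3) ∈ tangentSpace (ringConfig n θ) := by
      intro j
      by_cases hj : j = i
      · subst hj; simpa using hz
      · simp [Pi.single_eq_of_ne hj]
    have h1 := hξ.2 _ hT
    have h2 := (isRelativeEquilibrium_ring (κN := κN) (κS := κS) hn hθ).2 _ hT
    rw [fderiv_augmented_radial_of_tangent _ _ hx hT, Finset.sum_eq_single i
      (fun j _ hj => by simp [Pi.single_eq_of_ne hj]) (by simp)] at h1 h2
    simp only [Pi.single_eq_same, dotProduct_sub] at h1 h2 ⊢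
    linear_combination h2 - h1
  have k0 := key (Sum.inr 0) ![1, 0, 0] (by simp [northPole])
  have k1 := key (Sum.inr 0) ![0, 1, 0] (by simp [northPole])
  have hpos : 0 < n := by omega
  have k2 := key (Sum.inl ⟨0, hpos⟩) (meridian θ (longitude n ⟨0, hpos⟩))
    (by simp [spherePoint_dot_meridian])
  rw [Matrix.vec3_dotProduct] at k0 k1 k2
  simp [northPole, hN, meridian] at k0 k1 k2
  rw [k0, k1] at k2
  ext k
  fin_cases k
  · simpa [northPole] using k0
  · simpa [northPole] using k1
  · simpa [northPole, hθ, sub_eq_zero] using k2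

end Ring

/-! ### The Hessian on the Fourier modes -/

section Modes

open Real (sin cos)

variable {n : ℕ} {θ κN κS : ℝ}

/-- The components at the vertex `s` of a tangent vector against the vertex `t`. -/
theorem dot_spherePoint_of_tangent {α : ℝ} {w : R3} (hw : spherePoint θ α ⬝ᵥ w = 0) (β : ℝ) :
    w ⬝ᵥ spherePoint θ β = -(w ⬝ᵥ meridian θ α) * (sin θ * cos θ * (1 - cos (β - α))) +
      w ⬝ᵥ parallel α * (sin θ * sin (β - α)) := by
  conv_lhs => rw [eq_meridian_add_parallel hw]
  simp only [add_dotProduct, smul_dotProduct, smul_eq_mul, meridian_dot_spherePoint,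
    parallel_dot_spherePoint]
  ring

theorem dot_meridian_of_tangent {α : ℝ} {w : R3} (hw : spherePoint θ α ⬝ᵥ w = 0) (β : ℝ) :
    w ⬝ᵥ meridian θ β = w ⬝ᵥ meridian θ α * (1 - cos θ ^ 2 * (1 - cos (β - α))) +
      w ⬝ᵥ parallel α * (cos θ * sin (β - α)) := by
  conv_lhs => rw [eq_meridian_add_parallel hw]
  simp only [add_dotProduct, smul_dotProduct, smul_eq_mul, meridian_dot_meridian,
    parallel_dot_meridian]

theorem dot_parallel_of_tangent {α : ℝ} {w : R3} (hw : spherePoint θ α ⬝ᵥ w = 0) (β : ℝ) :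
    w ⬝ᵥ parallel β = -(w ⬝ᵥ meridian θ α) * (cos θ * sin (β - α)) +
      w ⬝ᵥ parallel α * cos (β - α) := by
  conv_lhs => rw [eq_meridian_add_parallel hw]
  simp only [add_dotProduct, smul_dotProduct, smul_eq_mul, meridian_dot_parallel,
    parallel_dot_parallel]
  ring

theorem dot_northPole_of_tangent {α : ℝ} {w : R3} (hw : spherePoint θ α ⬝ᵥ w = 0) :
    w ⬝ᵥ northPole = -(w ⬝ᵥ meridian θ α) * sin θ := by
  conv_lhs => rw [eq_meridian_add_parallel hw]
  simp only [add_dotProduct, smul_dotProduct, smul_eq_mul, meridian_dot_northPole,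
    parallel_dot_northPole]
  ring

/-- The row of the Hessian at the vortex `i`. -/
noncomputable def hessianRow {ι : Type} [Fintype ι] [DecidableEq ι] (κ : ι → ℝ) (ξ : R3)
    (x v : ι → R3) (i : ι) (w : R3) : ℝ :=
  ∑ j ∈ Finset.univ.erase i, κ j *
    ((w ⬝ᵥ v j - (w ⬝ᵥ v i) * (x i ⬝ᵥ x j)) / (1 - x i ⬝ᵥ x j) +
      (w ⬝ᵥ x j) * (v i ⬝ᵥ x j + x i ⬝ᵥ v j) / (1 - x i ⬝ᵥ x j) ^ 2) +
    (w ⬝ᵥ v i) * (x i ⬝ᵥ ξ)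

/-- The odd terms cancel over the ring, leaving only the meridional component of `w`. A pole
contributes `κ (1 ± cos θ)`, and the term of `ξ` contributes `± κ cos θ (1 ± cos θ)`; together they
form the squares. In the same way the ring terms `n - 1` and `(n - 1) cos² θ` combine. -/
theorem hessianRow_thetaVariation (hθ : sin θ ≠ 0) (a : Fin n → ℝ) (s : Fin n) {w : R3}
    (hw : spherePoint θ (longitude n s) ⬝ᵥ w = 0) :
    hessianRow (ringVorticity n κN κS) (ringAngularSpeed n θ κN κS • northPole) (ringConfig n θ)
      (thetaVariation n θ a) (Sum.inl s) w =
    w ⬝ᵥ meridian θ (longitude n s) / sin θ ^ 2 *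
      (a s * (κN * (1 + cos θ) ^ 2 + κS * (1 - cos θ) ^ 2 + (n - 1) * (1 + cos θ ^ 2)) -
        ∑ t ∈ Finset.univ.erase s, (a s - a t) /
          (1 - cos (longitude n t - longitude n s))) := by
  have h1 := one_sub_cos_ne_zero hθ
  have h2 := one_add_cos_ne_zero hθ
  have hs : sin θ ^ 2 = (1 - cos θ) * (1 + cos θ) := by
    linear_combination Real.sin_sq_add_cos_sq θ
  have hN : w ⬝ᵥ northPole = _ := dot_northPole_of_tangent hw
  set p := w ⬝ᵥ meridian θ (longitude n s) with hp
  set q := w ⬝ᵥ parallel (longitude n s) with hq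
  rw [hessianRow, sum_erase_inl]
  have hpair : ∀ t ∈ Finset.univ.erase s, ringVorticity n κN κS (Sum.inl t) *
      ((w ⬝ᵥ thetaVariation n θ a (Sum.inl t) - (w ⬝ᵥ thetaVariation n θ a (Sum.inl s)) *
        (ringConfig n θ (Sum.inl s) ⬝ᵥ ringConfig n θ (Sum.inl t))) /
        (1 - ringConfig n θ (Sum.inl s) ⬝ᵥ ringConfig n θ (Sum.inl t)) +
      (w ⬝ᵥ ringConfig n θ (Sum.inl t)) * (thetaVariation n θ a (Sum.inl s) ⬝ᵥ
        ringConfig n θ (Sum.inl t) + ringConfig n θ (Sum.inl s) ⬝ᵥ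
        thetaVariation n θ a (Sum.inl t)) /
        (1 - ringConfig n θ (Sum.inl s) ⬝ᵥ ringConfig n θ (Sum.inl t)) ^ 2) =
      p * a s / sin θ ^ 2 * 1 - p / sin θ ^ 2 * ((a s - a t) /
        (1 - cos (longitude n t - longitude n s))) - q * a s * cos θ / sin θ ^ 2 *
        (sin ((1 : ℕ) * (longitude n t - longitude n s)) /
          (1 - cos (longitude n t - longitude n s))) := by
    intro t ht
    have hne := one_sub_cos_longitude_ne_zero (Finset.ne_of_mem_erase ht)
    simp only [ringConfig_inl, ringVorticity_inl, thetaVariation_inl, dotProduct_smul,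
      smul_dotProduct, smul_eq_mul, dot_spherePoint_of_tangent hw (longitude n t),
      dot_meridian_of_tangent hw (longitude n t), ← hp, ← hq, meridian_dot_spherePoint,
      spherePoint_dot_meridian, spherePoint_dot_spherePoint, Nat.cast_one, one_mul, sub_sub_cancel]
    generalize longitude n t - longitude n s = x at hne ⊢
    field_simp
    linear_combination p * a s * (1 - cos x) * Real.sin_sq_add_cos_sq θ
  rw [Finset.sum_congr rfl hpair, Finset.sum_sub_distrib, Finset.sum_sub_distrib, ← Finset.mul_sum,
    ← Finset.mul_sum, ← Finset.mul_sum, sum_erase_one, sum_sin_div]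
  -- The left sides copy the unfolded polar terms, zeros included, so that they can be rewritten in
  -- place.
  have hN1 : (0 - p * a s * cos θ) / (1 - cos θ) + -p * sin θ * (a s * -sin θ + 0) /
      (1 - cos θ) ^ 2 = p * a s * (1 + cos θ) / sin θ ^ 2 := by
    rw [← div_one_sub_cos hθ]
    field_simp
    linear_combination p * a s * hs
  have hS1 : (0 - p * a s * -cos θ) / (1 - -cos θ) + -(-p * sin θ) * (-(a s * -sin θ) + 0) /
      (1 - -cos θ) ^ 2 = p * a s * (1 - cos θ) / sin θ ^ 2 := by
    rw [← div_one_add_cos hθ, sub_neg_eq_add]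
    field_simp
    linear_combination p * a s * hs
  simp only [ringConfig_inl, ringConfig_north, ringConfig_south, ringVorticity_north,
    ringVorticity_south, thetaVariation_inl, thetaVariation_inr, dotProduct_smul, smul_dotProduct,
    dotProduct_neg, spherePoint_dot_northPole, hN, dotProduct_zero, ← hp, meridian_dot_northPole,
    smul_eq_mul]
  rw [mul_comm (a s) p, hN1, hS1, ringAngularSpeed]
  field_simp
  ring

/-- The polar terms and the diagonal ring terms cancel exactly against the term of `ξ`. Only
differences `b s - b t` survive, as rotation invariance about the axis demands. -/
theorem hessianRow_phiVariation (hθ : sin θ ≠ 0) (b : Fin n → ℝ) (s : Fin n) {w : R3}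
    (hw : spherePoint θ (longitude n s) ⬝ᵥ w = 0) :
    hessianRow (ringVorticity n κN κS) (ringAngularSpeed n θ κN κS • northPole) (ringConfig n θ)
      (phiVariation n θ b) (Sum.inl s) w =
    w ⬝ᵥ parallel (longitude n s) / sin θ * ∑ t ∈ Finset.univ.erase s, (b s - b t) /
          (1 - cos (longitude n t - longitude n s)) := by
  have hN : w ⬝ᵥ northPole = _ := dot_northPole_of_tangent hw
  set p := w ⬝ᵥ meridian θ (longitude n s) with hp
  set q := w ⬝ᵥ parallel (longitude n s) with hq
  rw [hessianRow, sum_erase_inl]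
  have hpair : ∀ t ∈ Finset.univ.erase s, ringVorticity n κN κS (Sum.inl t) *
      ((w ⬝ᵥ phiVariation n θ b (Sum.inl t) - (w ⬝ᵥ phiVariation n θ b (Sum.inl s)) *
        (ringConfig n θ (Sum.inl s) ⬝ᵥ ringConfig n θ (Sum.inl t))) /
        (1 - ringConfig n θ (Sum.inl s) ⬝ᵥ ringConfig n θ (Sum.inl t)) +
      (w ⬝ᵥ ringConfig n θ (Sum.inl t)) * (phiVariation n θ b (Sum.inl s) ⬝ᵥ
        ringConfig n θ (Sum.inl t) + ringConfig n θ (Sum.inl s) ⬝ᵥ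
        phiVariation n θ b (Sum.inl t)) /
        (1 - ringConfig n θ (Sum.inl s) ⬝ᵥ ringConfig n θ (Sum.inl t)) ^ 2) =
      q / sin θ * ((b s - b t) / (1 - cos (longitude n t - longitude n s))) -
        q * b s * cos θ ^ 2 / sin θ * 1 - p * b s * cos θ / sin θ *
        (sin ((1 : ℕ) * (longitude n t - longitude n s)) /
          (1 - cos (longitude n t - longitude n s))) := by
    intro t ht
    have hne := one_sub_cos_longitude_ne_zero (Finset.ne_of_mem_erase ht)
    simp only [ringConfig_inl, ringVorticity_inl, phiVariation_inl, dotProduct_smul,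
      smul_dotProduct, smul_eq_mul, dot_spherePoint_of_tangent hw (longitude n t),
      dot_parallel_of_tangent hw (longitude n t), ← hp, ← hq, parallel_dot_spherePoint,
      spherePoint_dot_parallel, spherePoint_dot_spherePoint, Nat.cast_one, one_mul, sub_sub_cancel]
    generalize longitude n t - longitude n s = x at hne ⊢
    field_simp
    linear_combination q * (b s - b t) * Real.sin_sq_add_cos_sq x +
      q * b s * (1 - cos x) ^ 2 * Real.sin_sq_add_cos_sq θ
  rw [Finset.sum_congr rfl hpair, Finset.sum_sub_distrib, Finset.sum_sub_distrib, ← Finset.mul_sum,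
    ← Finset.mul_sum, ← Finset.mul_sum, sum_erase_one, sum_sin_div]
  simp only [ringConfig_inl, ringConfig_north, ringConfig_south, ringVorticity_north,
    ringVorticity_south, phiVariation_inl, phiVariation_inr, dotProduct_smul, smul_dotProduct,
    dotProduct_neg, spherePoint_dot_northPole, hN, dotProduct_zero, ← hq, parallel_dot_northPole,
    smul_eq_mul, ringAngularSpeed, sub_neg_eq_add, mul_zero, add_zero, neg_zero, zero_div, zero_sub,
    div_one_sub_cos hθ, div_one_add_cos hθ]
  field_simp
  ring

/-- The Fourier mode `cos (l φ + d)`. -/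
noncomputable def ringMode (n l : ℕ) (d : ℝ) (s : Fin n) : ℝ := cos (l * longitude n s + d)

theorem sum_ringMode {l : ℕ} (hl : 2 ≤ l) (hln : l + 1 < n) (d : ℝ) :
    ∑ s, ringMode n l d s = 0 :=
  sum_cos_longitude (by omega) (by omega) d

/-- The product has frequencies `l - 1` and `l + 1`. The bounds on `l` keep both strictly between
`0` and `n`, so both sums vanish. -/
theorem sum_ringMode_mul_cos {l : ℕ} (hl : 2 ≤ l) (hln : l + 1 < n) (d e : ℝ) :
    ∑ s, ringMode n l d s * cos (longitude n s + e) = 0 := by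
  obtain ⟨k, rfl⟩ : ∃ k, l = k + 1 := ⟨l - 1, by omega⟩
  have h1 := sum_cos_longitude (n := n) (l := k + 1 + 1) (by omega) hln (d + e)
  have h2 := sum_cos_longitude (n := n) (l := k) (by omega) (by omega) (d - e)
  have h3 : ∀ s, ringMode n (k + 1) d s * cos (longitude n s + e) =
      (1 / 2) * cos ((k + 1 + 1 : ℕ) * longitude n s + (d + e)) +
      (1 / 2) * cos (k * longitude n s + (d - e)) := by
    intro s
    have e1 : ((k + 1 + 1 : ℕ) : ℝ) * longitude n s + (d + e) =
      ((k + 1 : ℕ) * longitude n s + d) + (longitude n s + e) := by push_cast; ring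
    have e2 : (k : ℝ) * longitude n s + (d - e) =
      ((k + 1 : ℕ) * longitude n s + d) - (longitude n s + e) := by push_cast; ring
    rw [e1, e2, Real.cos_add (_ + d), Real.cos_sub (_ + d), ringMode]
    ring
  rw [Finset.sum_congr rfl fun s _ => h3 s, Finset.sum_add_distrib, ← Finset.mul_sum,
    ← Finset.mul_sum, h1, h2]
  ring

theorem sum_ringMode_mul_cos' {l : ℕ} (hl : 2 ≤ l) (hln : l + 1 < n) (d : ℝ) :
    ∑ s, ringMode n l d s * cos (longitude n s) = 0 := by
  simpa using sum_ringMode_mul_cos hl hln d 0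

theorem sum_ringMode_mul_sin {l : ℕ} (hl : 2 ≤ l) (hln : l + 1 < n) (d : ℝ) :
    ∑ s, ringMode n l d s * sin (longitude n s) = 0 := by
  simpa [← sub_eq_add_neg, Real.cos_sub_pi_div_two] using
    sum_ringMode_mul_cos hl hln d (-(Real.pi / 2))

/-- A pole does not interact with the higher Fourier modes. -/
theorem sum_ringMode_mul_horizontal {l : ℕ} (hl : 2 ≤ l) (hln : l + 1 < n) (d c₁ c₂ : ℝ) :
    ∑ s, ringMode n l d s * (c₁ * cos (longitude n s) + c₂ * sin (longitude n s)) = 0 := by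
  have h : ∀ s, ringMode n l d s * (c₁ * cos (longitude n s) + c₂ * sin (longitude n s)) =
      c₁ * (ringMode n l d s * cos (longitude n s)) +
      c₂ * (ringMode n l d s * sin (longitude n s)) := fun s => by ring
  rw [Finset.sum_congr rfl fun s _ => h s, Finset.sum_add_distrib, ← Finset.mul_sum,
    ← Finset.mul_sum, sum_ringMode_mul_cos' hl hln, sum_ringMode_mul_sin hl hln]
  ring

/-- All ring vortices have the same distance to the pole and `w` is horizontal, so the coupling is
the mode summed against a combination of `cos` and `sin` of the longitude. -/
theorem hessianRow_pole_thetaVariation {l : ℕ} (hl : 2 ≤ l) (hln : l + 1 < n) (d : ℝ) (k : Fin 2)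
    (ξ : R3) {w : R3} (hw : ringConfig n θ (Sum.inr k) ⬝ᵥ w = 0) :
    hessianRow (ringVorticity n κN κS) ξ (ringConfig n θ) (thetaVariation n θ (ringMode n l d))
      (Sum.inr k) w = 0 := by
  have key : ∀ e f : ℝ, w 2 = 0 →
      ∑ t, (ringMode n l d t * w ⬝ᵥ meridian θ (longitude n t) * e +
        w ⬝ᵥ spherePoint θ (longitude n t) * ringMode n l d t * f) = 0 := by
    intro e f hw2
    rw [← sum_ringMode_mul_horizontal hl hln d (w 0 * (cos θ * e + sin θ * f))
      (w 1 * (cos θ * e + sin θ * f))]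
    refine Finset.sum_congr rfl fun t _ => ?_
    simp only [meridian, spherePoint, Matrix.vec3_dotProduct, Matrix.cons_val, hw2]
    ring
  fin_cases k
  · have hw2 : w 2 = 0 := by
      simpa only [Fin.zero_eta, ringConfig_north, northPole, Matrix.vec3_dotProduct,
        Matrix.cons_val, zero_mul, zero_add, one_mul] using hw
    rw [hessianRow, Fin.zero_eta, sum_erase_north]
    simp only [ringVorticity_inl, thetaVariation_inl, thetaVariation_inr, ringConfig_inl,
      ringConfig_north, dotProduct_zero, zero_dotProduct, dotProduct_smul, smul_eq_mul,
      dotProduct_comm northPole (spherePoint _ _), dotProduct_comm northPole (meridian _ _),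
      spherePoint_dot_northPole, meridian_dot_northPole]
    simp only [zero_mul, sub_zero, zero_add, zero_div, mul_zero, add_zero]
    refine Eq.trans (Finset.sum_congr rfl fun t _ => ?_)
      (key (1 / (1 - cos θ)) (-sin θ / (1 - cos θ) ^ 2) hw2)
    ring
  · have hw2 : w 2 = 0 := by
      simpa only [Fin.mk_one, ringConfig_south, northPole, Matrix.vec3_dotProduct,
        neg_dotProduct, neg_eq_zero, Matrix.cons_val, zero_mul, zero_add, one_mul] using hw
    rw [hessianRow, Fin.mk_one, sum_erase_south]
    simp only [ringVorticity_inl, thetaVariation_inl, thetaVariation_inr, ringConfig_inl,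
      ringConfig_south, dotProduct_zero, zero_dotProduct, dotProduct_smul, smul_eq_mul,
      neg_dotProduct,
      dotProduct_comm northPole (spherePoint _ _), dotProduct_comm northPole (meridian _ _),
      spherePoint_dot_northPole, meridian_dot_northPole]
    simp only [zero_mul, sub_zero, zero_add, zero_div, mul_zero, add_zero]
    refine Eq.trans (Finset.sum_congr rfl fun t _ => ?_)
      (key (1 / (1 - -cos θ)) (sin θ / (1 - -cos θ) ^ 2) hw2)
    ring

theorem hessianRow_pole_phiVariation {l : ℕ} (hl : 2 ≤ l) (hln : l + 1 < n) (d : ℝ) (k : Fin 2)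
    (ξ : R3) {w : R3} (hw : ringConfig n θ (Sum.inr k) ⬝ᵥ w = 0) :
    hessianRow (ringVorticity n κN κS) ξ (ringConfig n θ) (phiVariation n θ (ringMode n l d))
      (Sum.inr k) w = 0 := by
  have key : ∀ e : ℝ, ∑ t, ringMode n l d t * sin θ * w ⬝ᵥ parallel (longitude n t) / e = 0 := by
    intro e
    rw [← sum_ringMode_mul_horizontal hl hln d (w 1 * sin θ / e) (-(w 0 * sin θ / e))]
    refine Finset.sum_congr rfl fun t _ => ?_
    simp only [parallel, Matrix.vec3_dotProduct, Matrix.cons_val]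
    ring
  fin_cases k
  · rw [hessianRow, Fin.zero_eta, sum_erase_north]
    simp only [ringVorticity_inl, phiVariation_inl, phiVariation_inr, ringConfig_inl,
      ringConfig_north, dotProduct_zero, zero_dotProduct, dotProduct_smul, smul_eq_mul,
      dotProduct_comm northPole (spherePoint _ _), dotProduct_comm northPole (parallel _),
      spherePoint_dot_northPole, parallel_dot_northPole]
    simp only [zero_mul, sub_zero, zero_div, mul_zero, add_zero, one_mul]
    exact key _
  · rw [hessianRow, Fin.mk_one, sum_erase_south]
    simp only [ringVorticity_inl, phiVariation_inl, phiVariation_inr, ringConfig_inl,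
      ringConfig_south, dotProduct_zero, zero_dotProduct, dotProduct_smul, smul_eq_mul,
      neg_dotProduct,
      dotProduct_comm northPole (spherePoint _ _), dotProduct_comm northPole (parallel _),
      spherePoint_dot_northPole, parallel_dot_northPole]
    simp only [zero_mul, sub_zero, zero_div, mul_zero, add_zero, one_mul, neg_zero]
    exact key _

/-- The eigenvalue of the Hessian on the `θ`-part of the `l`-mode, multiplied by `sin² θ`. -/
noncomputable def thetaEigenvalue (n : ℕ) (θ κN κS : ℝ) (l : ℕ) : ℝ :=
  κN * (1 + cos θ) ^ 2 + κS * (1 - cos θ) ^ 2 + (n - 1) * (1 + cos θ ^ 2) - l * (n - l)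

theorem thetaVariation_mem_tangentSpace (a : Fin n → ℝ) :
    thetaVariation n θ a ∈ tangentSpace (ringConfig n θ) := by
  rintro (s | k)
  · simp [spherePoint_dot_meridian]
  · simp

theorem phiVariation_mem_tangentSpace (a : Fin n → ℝ) :
    phiVariation n θ a ∈ tangentSpace (ringConfig n θ) := by
  rintro (s | k)
  · simp [spherePoint_dot_parallel]
  · simp

/-- Since `w` is an arbitrary tangent vector, this both diagonalizes the Hessian relative to the
metric and, compared with `symplecticForm_phiVariation`, determines the linearization. -/
theorem hessian_thetaVariation (hθ : sin θ ≠ 0) {l : ℕ} (hl : 2 ≤ l) (hln : l + 1 < n) (d : ℝ)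
    {w : Fin n ⊕ Fin 2 → R3} (hw : w ∈ tangentSpace (ringConfig n θ)) :
    hessian (ringVorticity n κN κS) (ringAngularSpeed n θ κN κS • northPole) (ringConfig n θ) w
      (thetaVariation n θ (ringMode n l d)) =
    thetaEigenvalue n θ κN κS l / sin θ ^ 2 *
      ∑ s, ringMode n l d s * w (Sum.inl s) ⬝ᵥ meridian θ (longitude n s) := by
  rw [hessian_eq_rows _ _ (ringConfig_mem_phaseSpace hθ) hw (thetaVariation_mem_tangentSpace _)]
  change ∑ i, ringVorticity n κN κS i * hessianRow _ _ _ _ i (w i) = _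
  rw [Fintype.sum_sum_type, Fintype.sum_eq_zero (fun k : Fin 2 => _) fun k => by
    rw [hessianRow_pole_thetaVariation hl hln d k _ (hw _), mul_zero], add_zero, Finset.mul_sum]
  refine Finset.sum_congr rfl fun s _ => ?_
  rw [hessianRow_thetaVariation hθ _ s (hw (Sum.inl s)), ringVorticity_inl]
  simp only [ringMode]
  rw [sum_mode_sub_div s (by omega), thetaEigenvalue]
  ring

theorem hessian_phiVariation (hθ : sin θ ≠ 0) {l : ℕ} (hl : 2 ≤ l) (hln : l + 1 < n) (d : ℝ)
    {w : Fin n ⊕ Fin 2 → R3} (hw : w ∈ tangentSpace (ringConfig n θ)) :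
    hessian (ringVorticity n κN κS) (ringAngularSpeed n θ κN κS • northPole) (ringConfig n θ) w
      (phiVariation n θ (ringMode n l d)) =
    l * (n - l) / sin θ *
      ∑ s, ringMode n l d s * w (Sum.inl s) ⬝ᵥ parallel (longitude n s) := by
  rw [hessian_eq_rows _ _ (ringConfig_mem_phaseSpace hθ) hw (phiVariation_mem_tangentSpace _)]
  change ∑ i, ringVorticity n κN κS i * hessianRow _ _ _ _ i (w i) = _
  rw [Fintype.sum_sum_type, Fintype.sum_eq_zero (fun k : Fin 2 => _) fun k => by
    rw [hessianRow_pole_phiVariation hl hln d k _ (hw _), mul_zero], add_zero, Finset.mul_sum]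
  refine Finset.sum_congr rfl fun s _ => ?_
  rw [hessianRow_phiVariation hθ _ s (hw (Sum.inl s)), ringVorticity_inl]
  simp only [ringMode]
  rw [sum_mode_sub_div s (by omega)]
  ring

/-! ### The symplectic form on the modes, and the modes in the slice -/

theorem parallel_cross_spherePoint (θ α : ℝ) : parallel α ⨯₃ spherePoint θ α = meridian θ α := by
  have h := Real.sin_sq_add_cos_sq α
  simp only [parallel, spherePoint, meridian, cross_apply]
  ext k
  fin_cases k <;> simp only [Matrix.cons_val, Fin.zero_eta, Fin.mk_one, Fin.reduceFinMk]
  · ring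
  · ring
  · linear_combination -sin θ * h

theorem meridian_cross_spherePoint (θ α : ℝ) :
    meridian θ α ⨯₃ spherePoint θ α = -parallel α := by
  have h := Real.sin_sq_add_cos_sq θ
  simp only [parallel, spherePoint, meridian, cross_apply]
  ext k
  fin_cases k <;> simp only [Matrix.cons_val, Fin.zero_eta, Fin.mk_one, Fin.reduceFinMk,
    Pi.neg_apply]
  · linear_combination sin α * h
  · linear_combination -cos α * h
  · ring

theorem symplecticForm_phiVariation (b : Fin n → ℝ) (w : Fin n ⊕ Fin 2 → R3) :
    symplecticForm (ringVorticity n κN κS) (ringConfig n θ) w (phiVariation n θ b) =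
      sin θ * ∑ s, b s * w (Sum.inl s) ⬝ᵥ meridian θ (longitude n s) := by
  simp only [symplecticForm, Fintype.sum_sum_type, ringVorticity_inl, ringConfig_inl,
    phiVariation_inl, phiVariation_inr, map_zero, dotProduct_zero, mul_zero, Finset.sum_const_zero,
    add_zero, Finset.mul_sum]
  refine Finset.sum_congr rfl fun s _ => ?_
  rw [triple_product_permutation, map_smul, LinearMap.smul_apply, parallel_cross_spherePoint,
    dotProduct_smul, smul_eq_mul]
  ring

theorem symplecticForm_thetaVariation (a : Fin n → ℝ) (w : Fin n ⊕ Fin 2 → R3) :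
    symplecticForm (ringVorticity n κN κS) (ringConfig n θ) w (thetaVariation n θ a) =
      -∑ s, a s * w (Sum.inl s) ⬝ᵥ parallel (longitude n s) := by
  simp only [symplecticForm, Fintype.sum_sum_type, ringVorticity_inl, ringConfig_inl,
    thetaVariation_inl, thetaVariation_inr, map_zero, dotProduct_zero, mul_zero,
    Finset.sum_const_zero, add_zero, ← Finset.sum_neg_distrib]
  refine Finset.sum_congr rfl fun s _ => ?_
  rw [triple_product_permutation, map_smul, LinearMap.smul_apply, meridian_cross_spherePoint,
    dotProduct_smul, smul_eq_mul, dotProduct_neg]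
  ring

/-- A horizontal variation with vanishing total rotation lies in the symplectic slice. -/
theorem mem_slice_ring (hn : 2 ≤ n)
    (hμ : momentum (ringVorticity n κN κS) (ringConfig n θ) ≠ 0) {u : Fin n ⊕ Fin 2 → R3}
    (hu : u ∈ tangentSpace (ringConfig n θ)) (h1 : momentum (ringVorticity n κN κS) u = 0)
    (h2 : ∑ i, (northPole ⨯₃ ringConfig n θ i) ⬝ᵥ u i = 0) :
    u ∈ slice (ringVorticity n κN κS) (ringConfig n θ) := by
  refine ⟨hu, h1, fun η hη => ?_⟩
  obtain ⟨c, rfl⟩ := eq_smul_of_cross_eq_zero hμ hη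
  simp only [momentum_ring hn, map_smul, LinearMap.smul_apply, smul_dotProduct, smul_eq_mul,
    ← Finset.mul_sum, h2, mul_zero]

theorem northPole_cross_spherePoint (θ α : ℝ) :
    northPole ⨯₃ spherePoint θ α = sin θ • parallel α := by
  simp only [parallel, spherePoint, northPole, cross_apply]
  ext k
  fin_cases k <;> simp

/-- The momentum of the variation consists of Fourier coefficients of orders `0` and `1`, which
vanish. Orthogonality to the rotation is automatic, meridians being orthogonal to parallels. -/
theorem thetaVariation_mem_slice {l : ℕ} (hl : 2 ≤ l) (hln : l + 1 < n) (d : ℝ)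
    (hμ : momentum (ringVorticity n κN κS) (ringConfig n θ) ≠ 0) :
    thetaVariation n θ (ringMode n l d) ∈ slice (ringVorticity n κN κS) (ringConfig n θ) := by
  refine mem_slice_ring (by omega) hμ (thetaVariation_mem_tangentSpace _) ?_ ?_
  · ext k
    have h0 := sum_ringMode hl hln d
    have hc := sum_ringMode_mul_cos' hl hln d
    have hs := sum_ringMode_mul_sin hl hln d
    fin_cases k <;> simp [momentum, meridian, mul_left_comm (ringMode n l d _),
      ← Finset.mul_sum, ← Finset.sum_mul, h0, hc, hs]
  · simp [northPole_cross_spherePoint, parallel_dot_meridian]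

theorem phiVariation_mem_slice {l : ℕ} (hl : 2 ≤ l) (hln : l + 1 < n) (d : ℝ)
    (hμ : momentum (ringVorticity n κN κS) (ringConfig n θ) ≠ 0) :
    phiVariation n θ (ringMode n l d) ∈ slice (ringVorticity n κN κS) (ringConfig n θ) := by
  refine mem_slice_ring (by omega) hμ (phiVariation_mem_tangentSpace _) ?_ ?_
  · ext k
    have hc := sum_ringMode_mul_cos' hl hln d
    have hs := sum_ringMode_mul_sin hl hln d
    fin_cases k <;> simp [momentum, parallel, mul_right_comm (ringMode n l d _) (sin θ),
      ← Finset.sum_mul, hc, hs]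
  · simp [northPole_cross_spherePoint, parallel_dot_parallel, ← Finset.sum_mul,
      sum_ringMode hl hln d]

end Modes

/-! ### Stability and instability of the ring -/

section Stability

/-- The Hessian as a bilinear form. -/
noncomputable def hessianBilin {ι : Type} [Fintype ι] [DecidableEq ι] (κ : ι → ℝ) (ξ : R3)
    (x : ι → R3) : (ι → R3) →ₗ[ℝ] (ι → R3) →ₗ[ℝ] ℝ :=
  LinearMap.mk₂ ℝ (hessian κ ξ x) (fun u v w => by simp [hessian]) (fun c u w => by simp [hessian])
    (fun u v w => by simp [hessian]) (fun c u w => by simp [hessian])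

/-- An invariant subspace of the slice on which the Hessian is positive definite is stable. -/
theorem isStableOnModes_of_hessian_pos {ι : Type} [Fintype ι] [DecidableEq ι] {κ : ι → ℝ} {ξ : R3}
    {x : ι → R3} (hx : x ∈ phaseSpace ι) {L : slice κ x →ₗ[ℝ] slice κ x}
    (hL : IsSliceLinearization κ ξ x L) {M : Submodule ℝ (ι → R3)} (hM : M ≤ slice κ x)
    (hinv : ∀ v ∈ M.submoduleOf (slice κ x), L v ∈ M.submoduleOf (slice κ x))
    (hpos : ∀ v ∈ M, v ≠ 0 → 0 < hessian κ ξ x v v) : IsStableOnModes κ ξ x L M := by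
  let ψ : M.submoduleOf (slice κ x) →ₗ[ℝ] (ι → R3) :=
    (Submodule.subtype _).comp (Submodule.subtype _)
  let B := (hessianBilin κ ξ x).compl₁₂ ψ ψ
  have hB : ∀ u v, B u v = hessian κ ξ x u.1.1 v.1.1 := fun _ _ => rfl
  have hsymm : ∀ u v, B u v = B v u := fun u v => by
    rw [hB, hB, hessian_symm hx u.1.2.1 v.1.2.1]
  have hpos' : ∀ v, v ≠ 0 → 0 < B v v := fun v hv => by
    rw [hB]
    exact hpos _ v.2 fun h1 => hv (Subtype.ext (Subtype.ext h1))
  have hskew : ∀ v, B v (L.restrict hinv v) = 0 := fun v => by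
    rw [hB]
    exact hL.hessian_apply_self hx v.1
  exact ⟨hM, Or.inl hpos, hinv, fun z hz => re_eq_zero_of_skew B hsymm hpos' hskew hz,
    fun v hv => exists_norm_le_of_skew B hsymm hpos' hskew hv⟩

open Real (sin cos)

variable {n : ℕ} {θ κN κS : ℝ}

/-- The Hessian against `δθ` and the symplectic form against `δφ` are the same functional of `w`,
with factors `λ_l / sin² θ` and `sin θ`; their quotient gives the cube. -/
theorem linearization_thetaVariation (hθ : sin θ ≠ 0) (hN : κN ≠ 0) (hS : κS ≠ 0)
    (hμ : momentum (ringVorticity n κN κS) (ringConfig n θ) ≠ 0)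
    {L : slice (ringVorticity n κN κS) (ringConfig n θ) →ₗ[ℝ]
      slice (ringVorticity n κN κS) (ringConfig n θ)}
    (hL : IsSliceLinearization (ringVorticity n κN κS)
      (ringAngularSpeed n θ κN κS • northPole) (ringConfig n θ) L)
    {l : ℕ} (hl : 2 ≤ l) (hln : l + 1 < n) (d : ℝ) :
    L ⟨_, thetaVariation_mem_slice hl hln d hμ⟩ =
      (thetaEigenvalue n θ κN κS l / sin θ ^ 3) • ⟨_, phiVariation_mem_slice hl hln d hμ⟩ := by
  refine hL.apply_eq (ringVorticity_ne_zero hN hS) (ringConfig_mem_phaseSpace hθ) hμ fun w => ?_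
  rw [hessian_thetaVariation hθ hl hln d w.2.1]
  rw [Submodule.coe_smul, symplecticForm_smul, symplecticForm_phiVariation]
  field_simp

theorem linearization_phiVariation (hθ : sin θ ≠ 0) (hN : κN ≠ 0) (hS : κS ≠ 0)
    (hμ : momentum (ringVorticity n κN κS) (ringConfig n θ) ≠ 0)
    {L : slice (ringVorticity n κN κS) (ringConfig n θ) →ₗ[ℝ]
      slice (ringVorticity n κN κS) (ringConfig n θ)}
    (hL : IsSliceLinearization (ringVorticity n κN κS)
      (ringAngularSpeed n θ κN κS • northPole) (ringConfig n θ) L)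
    {l : ℕ} (hl : 2 ≤ l) (hln : l + 1 < n) (d : ℝ) :
    L ⟨_, phiVariation_mem_slice hl hln d hμ⟩ =
      (-(l * (n - l) / sin θ)) • ⟨_, thetaVariation_mem_slice hl hln d hμ⟩ := by
  refine hL.apply_eq (ringVorticity_ne_zero hN hS) (ringConfig_mem_phaseSpace hθ) hμ fun w => ?_
  rw [hessian_phiVariation hθ hl hln d w.2.1]
  rw [Submodule.coe_smul, symplecticForm_smul, symplecticForm_thetaVariation]
  ring

theorem ringConst_eq (n : ℕ) : ringConst n = ((n / 2 : ℕ) : ℝ) * (n - (n / 2 : ℕ)) := by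
  rw [ringConst]
  rcases Nat.even_or_odd' n with ⟨k, rfl | rfl⟩
  · rw [if_pos (even_two_mul k), show 2 * k / 2 = k by omega]
    push_cast
    ring
  · rw [if_neg (by simp), show (2 * k + 1) / 2 = k by omega]
    push_cast
    ring

/-- Here `n² - 4 l (n - l) = (n - 2 l)²`, an odd square, hence at least `1`, when `n` is odd. -/
theorem mul_sub_le_ringConst (n l : ℕ) : (l : ℝ) * (n - l) ≤ ringConst n := by
  rw [ringConst]
  split_ifs with h
  · nlinarith [sq_nonneg ((n : ℝ) - 2 * l)]
  · have h1 : (1 : ℤ) ≤ ((n : ℤ) - 2 * l) ^ 2 := by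
      have : (n : ℤ) - 2 * l ≠ 0 := fun h0 => h ⟨l, by omega⟩
      have := sq_nonneg ((n : ℤ) - 2 * l)
      have : ((n : ℤ) - 2 * l) ^ 2 ≠ 0 := pow_ne_zero 2 ‹_›
      omega
    have h2 : (1 : ℝ) ≤ ((n : ℝ) - 2 * l) ^ 2 := by exact_mod_cast h1
    linarith

/-- For `l = n / 2` the block is `L u = a v`, `L v = b u` with `a, b < 0`. So `r = √(a b)` is a real
eigenvalue, with eigenvector `r u + a v`. -/
theorem isLinearlyUnstable_ring (hn : 4 ≤ n) (h0 : 0 < sin θ) (hN : κN ≠ 0) (hS : κS ≠ 0)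
    (hμ : momentum (ringVorticity n κN κS) (ringConfig n θ) ≠ 0)
    {L : slice (ringVorticity n κN κS) (ringConfig n θ) →ₗ[ℝ]
      slice (ringVorticity n κN κS) (ringConfig n θ)}
    (hL : IsSliceLinearization (ringVorticity n κN κS)
      (ringAngularSpeed n θ κN κS • northPole) (ringConfig n θ) L)
    (h : κN * (1 + cos θ) ^ 2 + κS * (1 - cos θ) ^ 2 <
      ringConst n - (n - 1) * (1 + cos θ ^ 2)) : IsLinearlyUnstable L := by
  have hl : 2 ≤ n / 2 := by omega
  have hln : n / 2 + 1 < n := by omega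
  -- Phase `0` matters: for even `n` the sine mode of order `n / 2` vanishes at every vertex.
  have h1 := linearization_thetaVariation h0.ne' hN hS hμ hL hl hln 0
  have h2 := linearization_phiVariation h0.ne' hN hS hμ hL hl hln 0
  set u : slice (ringVorticity n κN κS) (ringConfig n θ) :=
    ⟨_, thetaVariation_mem_slice hl hln 0 hμ⟩ with hu
  set v : slice (ringVorticity n κN κS) (ringConfig n θ) :=
    ⟨_, phiVariation_mem_slice hl hln 0 hμ⟩ with hv
  set a := thetaEigenvalue n θ κN κS (n / 2) / sin θ ^ 3 with ha
  set b := -(((n / 2 : ℕ) : ℝ) * (n - (n / 2 : ℕ)) / sin θ) with hb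
  have ha0 : a < 0 := by
    refine div_neg_of_neg_of_pos ?_ (by positivity)
    rw [thetaEigenvalue, ← ringConst_eq]
    linarith
  have hb0 : b < 0 := by
    rw [hb, neg_lt_zero]
    have h3 : (0 : ℝ) < (n / 2 : ℕ) := by exact_mod_cast (by omega : 0 < n / 2)
    have h4 : (0 : ℝ) < n - (n / 2 : ℕ) := by
      rw [sub_pos]
      exact_mod_cast (by omega : n / 2 < n)
    positivity
  have hab : 0 < a * b := mul_pos_of_neg_of_neg ha0 hb0
  set r := Real.sqrt (a * b) with hr
  have hr0 : 0 < r := Real.sqrt_pos.2 hab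
  have hrr : r * r = a * b := Real.mul_self_sqrt hab.le
  refine ⟨r, by simpa using hr0, hasEigenvalue_baseChange_of_apply_eq (v := r • u + a • v) ?_ ?_⟩
  · intro h5
    -- Vertical coordinate at vertex `0`: the parallel is horizontal and the mode has value `1`,
    -- which leaves `-r sin θ ≠ 0`.
    have h6 := congrFun (congrFun (congrArg Subtype.val h5) (Sum.inl ⟨0, by omega⟩)) 2
    simp [hu, hv, meridian, parallel, ringMode, longitude, hr0.ne', h0.ne'] at h6
  · rw [map_add, map_smul, map_smul, h1, h2, smul_add, smul_smul, smul_smul, smul_smul, hrr,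
      add_comm]

theorem ringMode_zero (n l : ℕ) : ringMode n l 0 = fun s => cos (l * longitude n s) := by
  funext s
  simp [ringMode]

theorem ringMode_neg_pi_div_two (n l : ℕ) :
    ringMode n l (-(Real.pi / 2)) = fun s => sin (l * longitude n s) := by
  funext s
  rw [ringMode, ← sub_eq_add_neg, Real.cos_sub_pi_div_two]

/-- The four generators of a mode are the phases `0` and `-π / 2`, so a statement uniform in the
phase `d` suffices. -/
theorem higherModes_le {N : Submodule ℝ (Fin n ⊕ Fin 2 → R3)}
    (h : ∀ l d, 2 ≤ l → l ≤ n / 2 → thetaVariation n θ (ringMode n l d) ∈ N ∧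
      phiVariation n θ (ringMode n l d) ∈ N) : higherModes n θ ≤ N := by
  refine iSup₂_le fun l hl => Submodule.span_le.2 ?_
  obtain ⟨hl1, hl2⟩ := Finset.mem_Icc.1 hl
  have h1 := h l 0 hl1 hl2
  have h2 := h l (-(Real.pi / 2)) hl1 hl2
  rw [ringMode_zero] at h1
  rw [ringMode_neg_pi_div_two] at h2
  rintro u (rfl | rfl | rfl | rfl)
  exacts [h1.1, h2.1, h1.2, h2.2]

theorem ringMode_expand (n l : ℕ) (d : ℝ) (s : Fin n) : ringMode n l d s =
    cos d * cos (l * longitude n s) - sin d * sin (l * longitude n s) := by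
  rw [ringMode, Real.cos_add]
  ring

theorem thetaVariation_mem_higherModes {l : ℕ} (hl : 2 ≤ l) (hln : l ≤ n / 2) (d : ℝ) :
    thetaVariation n θ (ringMode n l d) ∈ higherModes n θ := by
  refine Submodule.mem_iSup_of_mem l (Submodule.mem_iSup_of_mem (Finset.mem_Icc.2 ⟨hl, hln⟩) ?_)
  have h : thetaVariation n θ (ringMode n l d) =
      cos d • thetaVariation n θ (fun s => cos (l * longitude n s)) -
      sin d • thetaVariation n θ (fun s => sin (l * longitude n s)) := by
    funext i
    rcases i with s | k
    · simp [ringMode_expand, sub_smul, mul_smul]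
    · simp
  rw [h]
  exact Submodule.sub_mem _ (Submodule.smul_mem _ _ (Submodule.subset_span (by simp)))
    (Submodule.smul_mem _ _ (Submodule.subset_span (by simp)))

theorem phiVariation_mem_higherModes {l : ℕ} (hl : 2 ≤ l) (hln : l ≤ n / 2) (d : ℝ) :
    phiVariation n θ (ringMode n l d) ∈ higherModes n θ := by
  refine Submodule.mem_iSup_of_mem l (Submodule.mem_iSup_of_mem (Finset.mem_Icc.2 ⟨hl, hln⟩) ?_)
  have h : phiVariation n θ (ringMode n l d) =
      cos d • phiVariation n θ (fun s => cos (l * longitude n s)) -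
      sin d • phiVariation n θ (fun s => sin (l * longitude n s)) := by
    funext i
    rcases i with s | k
    · simp [ringMode_expand, sub_smul, mul_smul, sub_mul]
    · simp
  rw [h]
  exact Submodule.sub_mem _ (Submodule.smul_mem _ _ (Submodule.subset_span (by simp)))
    (Submodule.smul_mem _ _ (Submodule.subset_span (by simp)))

/-- The product Riemannian metric as a bilinear form. -/
noncomputable def metricBilin (ι : Type) [Fintype ι] : (ι → R3) →ₗ[ℝ] (ι → R3) →ₗ[ℝ] ℝ :=
  LinearMap.mk₂ ℝ (fun u v => ∑ i, u i ⬝ᵥ v i)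
    (fun u v w => by simp [Finset.sum_add_distrib]) (fun c u w => by simp [Finset.mul_sum])
    (fun u v w => by simp [Finset.sum_add_distrib]) (fun c u w => by simp [Finset.mul_sum])

theorem metricBilin_apply {ι : Type} [Fintype ι] (u v : ι → R3) :
    metricBilin ι u v = ∑ i, u i ⬝ᵥ v i := rfl

theorem metricBilin_symm {ι : Type} [Fintype ι] (u v : ι → R3) :
    metricBilin ι u v = metricBilin ι v u := by
  simp only [metricBilin_apply, dotProduct_comm]

theorem metricBilin_self_pos {ι : Type} [Fintype ι] {v : ι → R3} (hv : v ≠ 0) :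
    0 < metricBilin ι v v := by
  obtain ⟨i, hi⟩ := Function.ne_iff.1 hv
  exact Finset.sum_pos' (fun i _ => dotProduct_self_nonneg_R3 _) ⟨i, Finset.mem_univ i,
    lt_of_le_of_ne (dotProduct_self_nonneg_R3 _) fun h => hi (dotProduct_self_eq_zero.1 h.symm)⟩

/-- Every generator is an eigenvector relative to the metric. The `θ`-eigenvalues are positive
because `l (n - l) ≤ c_n`, the `φ`-eigenvalues because `0 < l < n`. -/
theorem hessian_pos_of_mem_higherModes (h0 : sin θ ≠ 0)
    (h : ringConst n - (n - 1) * (1 + cos θ ^ 2) <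
      κN * (1 + cos θ) ^ 2 + κS * (1 - cos θ) ^ 2) {v : Fin n ⊕ Fin 2 → R3}
    (hv : v ∈ higherModes n θ) (hv0 : v ≠ 0) :
    0 < hessian (ringVorticity n κN κS) (ringAngularSpeed n θ κN κS • northPole)
      (ringConfig n θ) v v := by
  have hx := ringConfig_mem_phaseSpace (n := n) h0
  refine pos_of_mem_span_of_eigenvectors (tangentSpace (ringConfig n θ))
    (hessianBilin (ringVorticity n κN κS) (ringAngularSpeed n θ κN κS • northPole)
      (ringConfig n θ)) (metricBilin _) (fun u hu v hv => hessian_symm hx hu hv)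
    metricBilin_symm
    (fun v hv => metricBilin_self_pos hv)
    (S := {v | ∃ l d, (2 ≤ l ∧ l ≤ n / 2) ∧ (v = thetaVariation n θ (ringMode n l d) ∨
      v = phiVariation n θ (ringMode n l d))}) ?_ ?_ (higherModes_le (fun l d h1 h2 => ?_) hv) hv0
  · rintro v ⟨l, d, -, rfl | rfl⟩
    · exact thetaVariation_mem_tangentSpace _
    · exact phiVariation_mem_tangentSpace _
  · rintro v ⟨l, d, ⟨hl, hl2⟩, rfl | rfl⟩
    · refine ⟨thetaEigenvalue n θ κN κS l / sin θ ^ 2, div_pos ?_ (by positivity), fun w hw => ?_⟩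
      · rw [thetaEigenvalue]
        linarith [mul_sub_le_ringConst n l]
      · refine (hessian_thetaVariation h0 hl (by omega) d hw).trans ?_
        simp [metricBilin_apply]
    -- The second factor `sin θ` in the denominator is the length of `∂x/∂φ`.
    · refine ⟨l * (n - l) / sin θ ^ 2, div_pos ?_ (by positivity), fun w hw => ?_⟩
      · have h3 : (0 : ℝ) < l := by exact_mod_cast (by omega : 0 < l)
        have h4 : (0 : ℝ) < n - l := by
          rw [sub_pos]
          exact_mod_cast (by omega : l < n)
        positivity
      · refine (hessian_phiVariation h0 hl (by omega) d hw).trans ?_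
        simp only [metricBilin_apply, Fintype.sum_sum_type, phiVariation_inl, phiVariation_inr,
          dotProduct_zero, Finset.sum_const_zero, add_zero, dotProduct_smul, smul_eq_mul,
          mul_right_comm (ringMode n l d _) (sin θ), ← Finset.sum_mul]
        field_simp
  · exact ⟨Submodule.subset_span ⟨l, d, ⟨h1, h2⟩, Or.inl rfl⟩,
      Submodule.subset_span ⟨l, d, ⟨h1, h2⟩, Or.inr rfl⟩⟩

theorem isStableOnModes_ring (h0 : sin θ ≠ 0) (hN : κN ≠ 0) (hS : κS ≠ 0)
    (hμ : momentum (ringVorticity n κN κS) (ringConfig n θ) ≠ 0)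
    {L : slice (ringVorticity n κN κS) (ringConfig n θ) →ₗ[ℝ]
      slice (ringVorticity n κN κS) (ringConfig n θ)}
    (hL : IsSliceLinearization (ringVorticity n κN κS)
      (ringAngularSpeed n θ κN κS • northPole) (ringConfig n θ) L)
    (h : ringConst n - (n - 1) * (1 + cos θ ^ 2) <
      κN * (1 + cos θ) ^ 2 + κS * (1 - cos θ) ^ 2) :
    IsStableOnModes (ringVorticity n κN κS) (ringAngularSpeed n θ κN κS • northPole)
      (ringConfig n θ) L (higherModes n θ) := by
  have hx := ringConfig_mem_phaseSpace (n := n) h0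
  -- Invariance is phrased as an inclusion of subspaces of the ambient space, so that it can be
  -- checked on generators.
  have hle : higherModes n θ ≤ (((higherModes n θ).submoduleOf
      (slice (ringVorticity n κN κS) (ringConfig n θ))).comap L).map (Submodule.subtype _) := by
    refine higherModes_le fun l d hl hl2 => ⟨?_, ?_⟩
    · refine ⟨⟨_, thetaVariation_mem_slice hl (by omega) d hμ⟩, ?_, rfl⟩
      rw [SetLike.mem_coe, Submodule.mem_comap,
        linearization_thetaVariation h0 hN hS hμ hL hl (by omega) d]
      exact Submodule.smul_mem _ _ (phiVariation_mem_higherModes hl hl2 d)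
    · refine ⟨⟨_, phiVariation_mem_slice hl (by omega) d hμ⟩, ?_, rfl⟩
      rw [SetLike.mem_coe, Submodule.mem_comap,
        linearization_phiVariation h0 hN hS hμ hL hl (by omega) d]
      exact Submodule.smul_mem _ _ (thetaVariation_mem_higherModes hl hl2 d)
  refine isStableOnModes_of_hessian_pos hx hL (higherModes_le fun l d hl hl2 =>
    ⟨thetaVariation_mem_slice hl (by omega) d hμ, phiVariation_mem_slice hl (by omega) d hμ⟩)
    (fun v hv => ?_) fun v hv hv0 => hessian_pos_of_mem_higherModes h0 h hv hv0
  obtain ⟨u, hu, huv⟩ := hle hv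
  rw [← Subtype.ext huv]
  exact hu

end Stability

end PointVortex

theorem mainTheorem4 (n : ℕ) (hn : 4 ≤ n) (θ₀ : ℝ) (hθ₀ : 0 < θ₀) (hθ₀' : θ₀ < Real.pi)
    (κN κS : ℝ) (hκN : κN ≠ 0) (hκS : κS ≠ 0)
    (hμ : PointVortex.momentum (PointVortex.ringVorticity n κN κS)
      (PointVortex.ringConfig n θ₀) ≠ 0) :
    (∃! ξ : PointVortex.R3, PointVortex.IsRelativeEquilibrium
      (PointVortex.ringVorticity n κN κS) (PointVortex.ringConfig n θ₀) ξ) ∧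
    ∀ ξ : PointVortex.R3, PointVortex.IsRelativeEquilibrium
      (PointVortex.ringVorticity n κN κS) (PointVortex.ringConfig n θ₀) ξ →
      (∃! L, PointVortex.IsSliceLinearization
        (PointVortex.ringVorticity n κN κS) ξ (PointVortex.ringConfig n θ₀) L) ∧
      ∀ L, PointVortex.IsSliceLinearization
        (PointVortex.ringVorticity n κN κS) ξ (PointVortex.ringConfig n θ₀) L →
        (κN * (1 + Real.cos θ₀) ^ 2 + κS * (1 - Real.cos θ₀) ^ 2
            < PointVortex.ringConst n - (n - 1) * (1 + Real.cos θ₀ ^ 2) →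
          PointVortex.IsLinearlyUnstable L) ∧
        (PointVortex.ringConst n - (n - 1) * (1 + Real.cos θ₀ ^ 2)
            < κN * (1 + Real.cos θ₀) ^ 2 + κS * (1 - Real.cos θ₀) ^ 2 →
          PointVortex.IsStableOnModes (PointVortex.ringVorticity n κN κS) ξ
            (PointVortex.ringConfig n θ₀) L (PointVortex.higherModes n θ₀)) := by

  have hs := Real.sin_pos_of_pos_of_lt_pi hθ₀ hθ₀'
  have hξ := PointVortex.existsUnique_angularVelocity (κS := κS) (by omega : 2 ≤ n) hs.ne' hκN
  refine ⟨hξ, fun ξ hξ' => ⟨?_, fun L hL => ?_⟩⟩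
  · exact PointVortex.existsUnique_isSliceLinearization
      (PointVortex.ringVorticity_ne_zero hκN hκS) (PointVortex.ringConfig_mem_phaseSpace hs.ne') hμ ξ
  -- Uniqueness identifies the given `ξ` with the explicit vertical angular velocity.
  · obtain rfl := hξ.unique hξ' (PointVortex.isRelativeEquilibrium_ring (by omega) hs.ne')
    exact ⟨PointVortex.isLinearlyUnstable_ring hn hs hκN hκS hμ hL,
      PointVortex.isStableOnModes_ring hs.ne' hκN hκS hμ hL⟩
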